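/- **Definitions.** A *symmetric monoidal functor* is a lax symmetric monoidal functor ($m_1 : 1 \to F1$, $m_{A,B} : FA\otimes FB \to F(A\otimes B)$), a *symmetric comonoidal functor* is an oplax one; a *symmetric (co)monoidal adjunction* is an adjunction between symmetric (co)monoidal functors whose unit and counit are (co)monoidal natural transformations. A *symmetric linearly distributive category* (Cockett–Seely) is a category $\mathcal L$ with two symmetric monoidal structures, a tensor $(\otimes,1)$ and a par $(\wp,\bot)$ and a natural transformation $\delta_{A,B,C} : A\otimes(B\mathbin{\wp}C)\to(A\otimes B)\mathbin{\wp}C$ compatible with the units and associativities of $\otimes$ and $\wp$, and such that $\delta$ and the distribution $(A\mathbin{\wp}B)\otimes C\to A\mathbin{\wp}(B\otimes C)$ obtained from it by the symmetries satisfy the two mixed coherence conditions on $A\otimes(B\mathbin{\wp}C)\otimes D$ and $(A\mathbin{\wp}B)\otimes(C\mathbin{\wp}D)$. It *has negation* if there are a map $A\mapsto A^\bot$ on objects and maps $\gamma^\bot_A : A^\bot\otimes A\to\bot$, $\gamma^1_A : 1\to A^\bot\mathbin{\wp}A$ satisfying the two triangle identities (with $\delta$) on $A$ and on $A^\bot$.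 Then every $f : A\to B$ has a dual $f^\bot : B^\bot\to A^\bot$. An *LPC model* consists of: 1. a symmetric linearly distributive category $\mathcal L$ with negation, finite products and finite coproducts; 2. symmetric monoidal categories $(\mathcal P,\otimes,1)$ and $(\mathcal C,\mathbin{\wp},\bot)$ with contravariant functors $(-)^* : \mathcal P\to\mathcal C$, symmetric monoidal, and $(-)_* : \mathcal C\to\mathcal P$, symmetric comonoidal, and natural isomorphisms $(C_*)^*\cong C$ and $P\cong (P^*)_*$; 3. monoidal natural transformations $e_P : P\to 1$, $d_P : P\to P\otimes P$ in $\mathcal P$ making every $P$ a commutative comonoid, and comonoidal natural transformations $e_C : \bot\to C$, $d_C : C\mathbin{\wp}C\to C$ in $\mathcal C$ making every $C$ a commutative monoid, interchanged by $(-)^*$ and by $(-)_*$; 4. symmetric monoidal functors $\lfloor-\rfloor : \mathcal L\to\mathcal P$ and $F_! : \mathcal P\to\mathcal L$ (for $\otimes$) and symmetric comonoidal functors $\lceil-\rceil : \mathcal L\to\mathcal C$ and $F_? : \mathcal C\to\mathcal L$ (for $\wp$), with natural isomorphisms $(F_!P)^\bot\cong F_?(P^*)$ and $\lfloor A\rfloor^*\cong\lceil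 A^\bot\rceil$, a symmetric monoidal adjunction $F_!\dashv\lfloor-\rfloor$ and a symmetric comonoidal adjunction $\lceil-\rceil\dashv F_?$. A *linear exponential comonad* on a symmetric monoidal category is a symmetric monoidal comonad $!$ (a comonad whose functor is symmetric monoidal and whose counit and comultiplication are monoidal) with monoidal natural transformations $e_A : {!A}\to 1$ and $d_A : {!A}\to {!A}\otimes{!A}$ such that each $({!A},d_A,e_A)$ is a commutative comonoid, $e_A$ and $d_A$ are morphisms of $!$-coalgebras, and every coalgebra morphism between free coalgebras ${!A}\to{!B}$ is a morphism of comonoids. A *linear exponential monad* is the dual notion. A symmetric monoidal category $(\mathcal L,\otimes,1)$ is a *model for classical linear logic* (Schalk) if it is *-autonomous (symmetric monoidal closed with an object $\bot$ such that every canonical map $A\to(A\multimap\bot)\multimap\bot$ is an isomorphism), has finite products and finite coproducts, and has a linear exponential comonad $!$; its dual monad is ${?A} = {!(A\multimap\bot)}\multimap\bot$. **Proposition.** In every LPC model, $(\mathcal L,\otimes,1)$ is a model for classical linear logic. More precisely, $\mathcal L$ is *-autonomous with dualizing object the unit $\bot$ of $\wp$, and the canonical maps $A^\bot\mathbin{\wp}B\to(A\multimap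 B)$, induced by the evaluation $A\otimes(A^\bot\mathbin{\wp}B)\to(A\otimes A^\bot)\mathbin{\wp}B\to\bot\mathbin{\wp}B\cong B$, are isomorphisms; $\mathcal L$ has finite products and finite coproducts; the comonad ${!} = F_!\lfloor-\rfloor$ of the adjunction $F_!\dashv\lfloor-\rfloor$ carries the structure of a linear exponential comonad on $(\mathcal L,\otimes,1)$; the monad ${?} = F_?\lceil-\rceil$ of the adjunction $\lceil-\rceil\dashv F_?$ carries the structure of a linear exponential monad on $(\mathcal L,\mathbin{\wp},\bot)$; and this monad is isomorphic, as a monad, to the dual monad $A\mapsto{!(A\multimap\bot)}\multimap\bot$ of $!$. -/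

import Mathlib

open CategoryTheory MonoidalCategory Opposite Limits

universe v₁ v₂ v₃ u₁ u₂ u₃

namespace LPC

/-! ### Symmetric comonoidal functors, comonoidal natural transformations, adjunctions -/

section Functors

variable {C : Type u₁} [Category.{v₁} C] [MonoidalCategory C] [BraidedCategory C]
variable {D : Type u₂} [Category.{v₂} D] [MonoidalCategory D] [BraidedCategory D]

/-- Symmetric comonoidal functors (symmetric monoidal functors are `Functor.LaxBraided`). -/
class SymmetricComonoidal (F : C ⥤ D) extends F.OplaxMonoidal where
  braided (X Y : C) :
    F.map (β_ X Y).hom ≫ δ Y X = δ X Y ≫ (β_ (F.obj X) (F.obj Y)).hom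

/-- Comonoidal natural transformations (monoidal ones are `NatTrans.IsMonoidal`). -/
structure IsComonoidal {F G : C ⥤ D} [F.OplaxMonoidal] [G.OplaxMonoidal] (τ : F ⟶ G) :
    Prop where
  unit : τ.app (𝟙_ C) ≫ Functor.OplaxMonoidal.η G = Functor.OplaxMonoidal.η F
  tensor (X Y : C) : τ.app (X ⊗ Y) ≫ Functor.OplaxMonoidal.δ G X Y =
    Functor.OplaxMonoidal.δ F X Y ≫ (τ.app X ⊗ₘ τ.app Y)

/-- Symmetric monoidal adjunctions: both functors are symmetric monoidal, and the unit and the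
counit are monoidal natural transformations. -/
structure IsMonoidalAdjunction {F : C ⥤ D} {G : D ⥤ C} [F.LaxBraided] [G.LaxBraided]
    (adj : F ⊣ G) : Prop where
  unit : NatTrans.IsMonoidal adj.unit
  counit : NatTrans.IsMonoidal adj.counit

/-- Symmetric comonoidal adjunctions. -/
structure IsComonoidalAdjunction {F : C ⥤ D} {G : D ⥤ C} [SymmetricComonoidal F]
    [SymmetricComonoidal G] (adj : F ⊣ G) : Prop where
  unit : IsComonoidal adj.unit
  counit : IsComonoidal adj.counit

end Functors

/-! ### Symmetric linearly distributive categories with negation -/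

/-- A second symmetric monoidal structure on `L`, written `⅋` with unit `⊥`. -/
class Par (L : Type u₁) [Category.{v₁} L] where
  monoidal : MonoidalCategory L
  symmetric : @SymmetricCategory L _ monoidal

section Par

variable {L : Type u₁} [Category.{v₁} L] [Par L]

/-- The object `A ⅋ B`. -/
def par (A B : L) : L := Par.monoidal.tensorObj A B

scoped infixr:70 " ⅋ " => par

variable (L) in
/-- The unit `⊥` of `⅋`. -/
def parUnit : L := (Par.monoidal (L := L)).tensorUnit

/-- The morphism `f ⅋ g`. -/
def parMap {A A' B B' : L} (f : A ⟶ A') (g : B ⟶ B') : A ⅋ B ⟶ A' ⅋ B' :=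
  Par.monoidal.tensorHom f g

/-- The associativity isomorphism of `⅋`. -/
def parAssoc (A B C : L) : (A ⅋ B) ⅋ C ≅ A ⅋ (B ⅋ C) := Par.monoidal.associator A B C

/-- The left unit isomorphism of `⅋`. -/
def parLeftUnitor (A : L) : parUnit L ⅋ A ≅ A := Par.monoidal.leftUnitor A

/-- The right unit isomorphism of `⅋`. -/
def parRightUnitor (A : L) : A ⅋ parUnit L ≅ A := Par.monoidal.rightUnitor A

/-- The symmetry of `⅋`. -/
def parSymm (A B : L) : A ⅋ B ≅ B ⅋ A := Par.symmetric.braiding A B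

end Par

section LinearlyDistributive

variable {L : Type u₁} [Category.{v₁} L] [MonoidalCategory L] [SymmetricCategory L] [Par L]

/-- The right distribution `(A ⅋ B) ⊗ C ⟶ A ⅋ (B ⊗ C)` obtained, by the symmetries of `⊗` and `⅋`,
from a left distribution `A ⊗ (B ⅋ C) ⟶ (A ⊗ B) ⅋ C`. -/
def rightDistOf (d : ∀ A B C : L, A ⊗ (B ⅋ C) ⟶ (A ⊗ B) ⅋ C) (A B C : L) :
    (A ⅋ B) ⊗ C ⟶ A ⅋ (B ⊗ C) :=
  (β_ (A ⅋ B) C).hom ≫ C ◁ (parSymm A B).hom ≫ d C B A ≫ (parSymm (C ⊗ B) A).hom ≫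
    parMap (𝟙 A) (β_ C B).hom

variable (L) in
/-- Symmetric linearly distributive categories, with the coherence conditions of
Cockett and Seely. In the symmetric case one distribution determines the others. -/
class LinearlyDistributive where
  /-- The distribution. -/
  dist (A B C : L) : A ⊗ (B ⅋ C) ⟶ (A ⊗ B) ⅋ C
  dist_natural {A A' B B' C C' : L} (f : A ⟶ A') (g : B ⟶ B') (h : C ⟶ C') :
    (f ⊗ₘ parMap g h) ≫ dist A' B' C' = dist A B C ≫ parMap (f ⊗ₘ g) h
  /-- Compatibility with the unit of `⊗`. -/
  dist_tensorUnit (A B : L) :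
    dist (𝟙_ L) A B ≫ parMap (λ_ A).hom (𝟙 B) = (λ_ (A ⅋ B)).hom
  /-- Compatibility with the unit of `⅋`. -/
  dist_parUnit (A B : L) :
    dist A B (parUnit L) ≫ (parRightUnitor (A ⊗ B)).hom = A ◁ (parRightUnitor B).hom
  /-- Compatibility with the associativity of `⊗`. -/
  dist_tensorAssoc (A B C D : L) :
    dist (A ⊗ B) C D ≫ parMap (α_ A B C).hom (𝟙 D) =
      (α_ A B (C ⅋ D)).hom ≫ A ◁ dist B C D ≫ dist A (B ⊗ C) D
  /-- Compatibility with the associativity of `⅋`. -/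
  dist_parAssoc (A B C D : L) :
    dist A (B ⅋ C) D ≫ parMap (dist A B C) (𝟙 D) ≫ (parAssoc (A ⊗ B) C D).hom =
      A ◁ (parAssoc B C D).hom ≫ dist A B (C ⅋ D)
  /-- The two distributions of `A` and `D` into `B ⅋ C` commute. -/
  dist_rightDist (A B C D : L) :
    dist A B C ▷ D ≫ rightDistOf dist (A ⊗ B) C D =
      (α_ A (B ⅋ C) D).hom ≫ A ◁ rightDistOf dist B C D ≫ dist A B (C ⊗ D)
  /-- The two ways of passing from `(A ⅋ B) ⊗ (C ⅋ D)` to `A ⅋ ((B ⊗ C) ⅋ D)` agree. -/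
  rightDist_dist (A B C D : L) :
    dist (A ⅋ B) C D ≫ parMap (rightDistOf dist A B C) (𝟙 D) ≫ (parAssoc A (B ⊗ C) D).hom =
      rightDistOf dist A B (C ⅋ D) ≫ parMap (𝟙 A) (dist B C D)

variable (L) in
/-- Negation on a symmetric linearly distributive category. -/
class Negation [LinearlyDistributive L] where
  /-- The dual `A^⊥`, a map on objects. -/
  neg : L → L
  /-- The map `A^⊥ ⊗ A ⟶ ⊥`. -/
  γbot (A : L) : neg A ⊗ A ⟶ parUnit L
  /-- The map `1 ⟶ A^⊥ ⅋ A`. -/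
  γone (A : L) : 𝟙_ L ⟶ neg A ⅋ A
  /-- The triangle identity on `A`. -/
  triangle (A : L) :
    (ρ_ A).inv ≫ A ◁ γone A ≫ LinearlyDistributive.dist A (neg A) A ≫
      parMap ((β_ A (neg A)).hom ≫ γbot A) (𝟙 A) ≫ (parLeftUnitor A).hom = 𝟙 A
  /-- The triangle identity on `A^⊥`. -/
  triangle_neg (A : L) :
    (ρ_ (neg A)).inv ≫ neg A ◁ (γone A ≫ (parSymm (neg A) A).hom) ≫
      LinearlyDistributive.dist (neg A) A (neg A) ≫
        parMap (γbot A) (𝟙 (neg A)) ≫ (parLeftUnitor (neg A)).hom = 𝟙 (neg A)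

variable [LinearlyDistributive L] [Negation L]

/-- The dual `A^⊥` of an object. -/
def neg (A : L) : L := Negation.neg A

/-- The dual `f^⊥ : B^⊥ ⟶ A^⊥` of a morphism `f : A ⟶ B`. -/
def negMap {A B : L} (f : A ⟶ B) : neg B ⟶ neg A :=
  (ρ_ (neg B)).inv ≫
    neg B ◁ (Negation.γone A ≫ parMap (𝟙 (neg A)) f ≫ (parSymm (neg A) B).hom) ≫
      LinearlyDistributive.dist (neg B) B (neg A) ≫
        parMap (Negation.γbot B) (𝟙 (neg A)) ≫ (parLeftUnitor (neg A)).hom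

/-- The evaluation `A ⊗ (A^⊥ ⅋ B) ⟶ B`. -/
def negEval (A B : L) : A ⊗ (neg A ⅋ B) ⟶ B :=
  LinearlyDistributive.dist A (neg A) B ≫
    parMap ((β_ A (neg A)).hom ≫ Negation.γbot A) (𝟙 B) ≫ (parLeftUnitor B).hom

end LinearlyDistributive

/-! ### Natural commutative comonoids and monoids -/

/-- Every object is a commutative comonoid, and the counits `e_X : X ⟶ 1` and comultiplications
`d_X : X ⟶ X ⊗ X` are monoidal natural transformations. -/
class NaturalComonoids (P : Type u₁) [Category.{v₁} P] [MonoidalCategory P]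
    [SymmetricCategory P] where
  [comonoid (X : P) : ComonObj X]
  [commutative (X : P) : IsCommComonObj X]
  e_natural {X Y : P} (f : X ⟶ Y) : f ≫ ComonObj.counit (X := Y) = ComonObj.counit
  d_natural {X Y : P} (f : X ⟶ Y) :
    f ≫ ComonObj.comul (X := Y) = ComonObj.comul ≫ (f ⊗ₘ f)
  e_unit : ComonObj.counit (X := 𝟙_ P) = 𝟙 (𝟙_ P)
  e_tensor (X Y : P) : ComonObj.counit (X := X ⊗ Y) =
    (ComonObj.counit (X := X) ⊗ₘ ComonObj.counit (X := Y)) ≫ (λ_ (𝟙_ P)).hom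
  d_unit : ComonObj.comul (X := 𝟙_ P) = (λ_ (𝟙_ P)).inv
  d_tensor (X Y : P) : ComonObj.comul (X := X ⊗ Y) =
    (ComonObj.comul (X := X) ⊗ₘ ComonObj.comul (X := Y)) ≫ tensorμ X X Y Y

/-- Every object is a commutative monoid, and the units `e_X : 1 ⟶ X` and multiplications
`d_X : X ⊗ X ⟶ X` are comonoidal natural transformations. -/
class NaturalMonoids (C : Type u₁) [Category.{v₁} C] [MonoidalCategory C]
    [SymmetricCategory C] where
  [monoid (X : C) : MonObj X]
  [commutative (X : C) : IsCommMonObj X]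
  e_natural {X Y : C} (f : X ⟶ Y) : MonObj.one (X := X) ≫ f = MonObj.one
  d_natural {X Y : C} (f : X ⟶ Y) :
    MonObj.mul (X := X) ≫ f = (f ⊗ₘ f) ≫ MonObj.mul
  e_unit : MonObj.one (X := 𝟙_ C) = 𝟙 (𝟙_ C)
  e_tensor (X Y : C) : MonObj.one (X := X ⊗ Y) =
    (λ_ (𝟙_ C)).inv ≫ (MonObj.one (X := X) ⊗ₘ MonObj.one (X := Y))
  d_unit : MonObj.mul (X := 𝟙_ C) = (λ_ (𝟙_ C)).hom
  d_tensor (X Y : C) : MonObj.mul (X := X ⊗ Y) =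
    tensorμ X Y X Y ≫ (MonObj.mul (X := X) ⊗ₘ MonObj.mul (X := Y))

attribute [reducible, instance] NaturalComonoids.comonoid NaturalMonoids.monoid
attribute [instance] NaturalComonoids.commutative NaturalMonoids.commutative

/-! ### LPC models -/

/-- A linear/producing/consuming model on categories `L`, `P`, `C`. -/
structure Model (L : Type u₁) [Category.{v₁} L] [MonoidalCategory L] [SymmetricCategory L]
    (P : Type u₂) [Category.{v₂} P] [MonoidalCategory P] [SymmetricCategory P]
    (C : Type u₃) [Category.{v₃} C] [MonoidalCategory C] [SymmetricCategory C] where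
  /-- `L` is a symmetric linearly distributive category with negation, finite products and
  finite coproducts. -/
  [par : Par L]
  [linearlyDistributive : LinearlyDistributive L]
  [negation : Negation L]
  [hasFiniteProducts : HasFiniteProducts L]
  [hasFiniteCoproducts : HasFiniteCoproducts L]
  /-- `P` and `C` are in duality by contravariant functors `(-)^* : P ⟶ C` and `(-)_* : C ⟶ P`,
  which are respectively symmetric monoidal and symmetric comonoidal. -/
  star : Pᵒᵖ ⥤ C
  lowerStar : Cᵒᵖ ⥤ P
  [star_monoidal : star.LaxBraided]
  [lowerStar_comonoidal : SymmetricComonoidal lowerStar]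
  /-- The natural isomorphism `(X_*)^* ≅ X`. -/
  starCounit : lowerStar.rightOp ⋙ star ≅ 𝟭 C
  /-- The natural isomorphism `X ≅ (X^*)_*`. -/
  starUnit : 𝟭 P ≅ star.rightOp ⋙ lowerStar
  /-- Natural commutative comonoids in `P` and commutative monoids in `C`, interchanged under
  duality. -/
  [comonoids : NaturalComonoids P]
  [monoids : NaturalMonoids C]
  star_e (X : P) : MonObj.one (X := star.obj (op X)) =
    Functor.LaxMonoidal.ε star ≫ star.map (ComonObj.counit (X := X)).op
  star_d (X : P) : MonObj.mul (X := star.obj (op X)) =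
    Functor.LaxMonoidal.μ star (op X) (op X) ≫ star.map (ComonObj.comul (X := X)).op
  lowerStar_e (X : C) : ComonObj.counit (X := lowerStar.obj (op X)) =
    lowerStar.map (MonObj.one (X := X)).op ≫ Functor.OplaxMonoidal.η lowerStar
  lowerStar_d (X : C) : ComonObj.comul (X := lowerStar.obj (op X)) =
    lowerStar.map (MonObj.mul (X := X)).op ≫ Functor.OplaxMonoidal.δ lowerStar (op X) (op X)
  /-- The functors `⌊-⌋ : L ⟶ P` and `F_! : P ⟶ L`, symmetric monoidal for `⊗`. -/
  floor : L ⥤ P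
  Fbang : P ⥤ L
  [floor_monoidal : floor.LaxBraided]
  [Fbang_monoidal : Fbang.LaxBraided]
  /-- The functors `⌈-⌉ : L ⟶ C` and `F_? : C ⟶ L`, symmetric comonoidal for `⅋`. -/
  ceil : L ⥤ C
  Fwhynot : C ⥤ L
  ceil_comonoidal : @SymmetricComonoidal L _ Par.monoidal Par.symmetric.toBraidedCategory C _ _ _ ceil
  Fwhynot_comonoidal : @SymmetricComonoidal C _ _ _ L _ Par.monoidal
    Par.symmetric.toBraidedCategory Fwhynot
  /-- The natural isomorphism `(F_! X)^⊥ ≅ F_? (X^*)`. -/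
  Fbang_neg (X : P) : neg (Fbang.obj X) ≅ Fwhynot.obj (star.obj (op X))
  Fbang_neg_natural {X Y : P} (f : X ⟶ Y) :
    negMap (Fbang.map f) ≫ (Fbang_neg X).hom =
      (Fbang_neg Y).hom ≫ Fwhynot.map (star.map f.op)
  /-- The natural isomorphism `⌊A⌋^* ≅ ⌈A^⊥⌉`. -/
  floor_star (A : L) : star.obj (op (floor.obj A)) ≅ ceil.obj (neg A)
  floor_star_natural {A B : L} (f : A ⟶ B) :
    star.map (floor.map f).op ≫ (floor_star A).hom =
      (floor_star B).hom ≫ ceil.map (negMap f)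
  /-- The symmetric monoidal adjunction `F_! ⊣ ⌊-⌋`. -/
  bangAdj : Fbang ⊣ floor
  bangAdj_monoidal : IsMonoidalAdjunction bangAdj
  /-- The symmetric comonoidal adjunction `⌈-⌉ ⊣ F_?`. -/
  whynotAdj : ceil ⊣ Fwhynot
  whynotAdj_comonoidal : @IsComonoidalAdjunction L _ Par.monoidal
    Par.symmetric.toBraidedCategory C _ _ _ ceil Fwhynot ceil_comonoidal Fwhynot_comonoidal whynotAdj

namespace Model

variable {L : Type u₁} [Category.{v₁} L] [MonoidalCategory L] [SymmetricCategory L]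
  {P : Type u₂} [Category.{v₂} P] [MonoidalCategory P] [SymmetricCategory P]
  {C : Type u₃} [Category.{v₃} C] [MonoidalCategory C] [SymmetricCategory C]

/-- The comonad `! = F_! ⌊-⌋` on `L`. -/
def bang (M : Model L P C) : Comonad L := M.bangAdj.toComonad

/-- The monad `? = F_? ⌈-⌉` on `L`. -/
def whynot (M : Model L P C) : Monad L := M.whynotAdj.toMonad

/-- The unit `⊥` of `⅋`. -/
def bot (M : Model L P C) : L :=
  letI := M.par
  parUnit L

/-- The object `A^⊥ ⅋ B`. -/
def lolly (M : Model L P C) (A B : L) : L :=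
  letI := M.par
  letI := M.linearlyDistributive
  letI := M.negation
  neg A ⅋ B

/-- The evaluation `A ⊗ (A^⊥ ⅋ B) ⟶ B`. -/
def lollyEval (M : Model L P C) (A B : L) : A ⊗ M.lolly A B ⟶ B :=
  letI := M.par
  letI := M.linearlyDistributive
  letI := M.negation
  negEval A B

end Model

/-! ### Linear exponential comonads and monads -/

section Exponential

variable {L : Type u₁} [Category.{v₁} L] [MonoidalCategory L] [SymmetricCategory L]

/-- A linear exponential comonad `!` on a symmetric monoidal category: a symmetric monoidal
comonad with monoidal natural transformations `e_A : !A ⟶ 1` and `d_A : !A ⟶ !A ⊗ !A` that make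
each `!A` a commutative comonoid, are morphisms of coalgebras, and are preserved by all coalgebra
morphisms between free coalgebras. -/
structure LinearExponentialComonad (G : Comonad L) where
  [lax : G.toFunctor.LaxBraided]
  ε_monoidal : NatTrans.IsMonoidal G.ε
  δ_monoidal : NatTrans.IsMonoidal G.δ
  [comonoid (A : L) : ComonObj (G.obj A)]
  [commutative (A : L) : IsCommComonObj (G.obj A)]
  e_natural {A B : L} (f : A ⟶ B) :
    G.map f ≫ ComonObj.counit (X := G.obj B) = ComonObj.counit
  d_natural {A B : L} (f : A ⟶ B) :
    G.map f ≫ ComonObj.comul (X := G.obj B) = ComonObj.comul ≫ (G.map f ⊗ₘ G.map f)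
  e_unit :
    Functor.LaxMonoidal.ε G.toFunctor ≫ ComonObj.counit (X := G.obj (𝟙_ L)) = 𝟙 (𝟙_ L)
  e_tensor (A B : L) :
    Functor.LaxMonoidal.μ G.toFunctor A B ≫ ComonObj.counit (X := G.obj (A ⊗ B)) =
      (ComonObj.counit (X := G.obj A) ⊗ₘ ComonObj.counit (X := G.obj B)) ≫ (λ_ (𝟙_ L)).hom
  d_unit :
    Functor.LaxMonoidal.ε G.toFunctor ≫ ComonObj.comul (X := G.obj (𝟙_ L)) =
      (λ_ (𝟙_ L)).inv ≫
        (Functor.LaxMonoidal.ε G.toFunctor ⊗ₘ Functor.LaxMonoidal.ε G.toFunctor)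
  d_tensor (A B : L) :
    Functor.LaxMonoidal.μ G.toFunctor A B ≫ ComonObj.comul (X := G.obj (A ⊗ B)) =
      (ComonObj.comul (X := G.obj A) ⊗ₘ ComonObj.comul (X := G.obj B)) ≫
        tensorμ (G.obj A) (G.obj A) (G.obj B) (G.obj B) ≫
          (Functor.LaxMonoidal.μ G.toFunctor A B ⊗ₘ Functor.LaxMonoidal.μ G.toFunctor A B)
  /-- `e_A` is a morphism from the free coalgebra `!A` to the coalgebra `1`. -/
  e_coalgebra (A : L) :
    G.δ.app A ≫ G.map (ComonObj.counit (X := G.obj A)) =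
      ComonObj.counit (X := G.obj A) ≫ Functor.LaxMonoidal.ε G.toFunctor
  /-- `d_A` is a morphism from the free coalgebra `!A` to the coalgebra `!A ⊗ !A`. -/
  d_coalgebra (A : L) :
    G.δ.app A ≫ G.map (ComonObj.comul (X := G.obj A)) =
      ComonObj.comul (X := G.obj A) ≫ (G.δ.app A ⊗ₘ G.δ.app A) ≫
        Functor.LaxMonoidal.μ G.toFunctor (G.obj A) (G.obj A)
  free_hom {A B : L} (f : G.obj A ⟶ G.obj B) :
    G.δ.app A ≫ G.map f = f ≫ G.δ.app B → IsComonHom f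

/-- A linear exponential monad `?` on a symmetric monoidal category, the dual notion: a symmetric
comonoidal monad with comonoidal natural transformations `e_A : 1 ⟶ ?A` and
`d_A : ?A ⊗ ?A ⟶ ?A` that make each `?A` a commutative monoid, are morphisms of algebras, and are
preserved by all algebra morphisms between free algebras. It will be used for `⅋`. -/
structure LinearExponentialMonad (T : Monad L) where
  [oplax : SymmetricComonoidal T.toFunctor]
  η_comonoidal : IsComonoidal T.η
  μ_comonoidal : IsComonoidal T.μ
  [monoid (A : L) : MonObj (T.obj A)]
  [commutative (A : L) : IsCommMonObj (T.obj A)]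
  e_natural {A B : L} (f : A ⟶ B) :
    MonObj.one (X := T.obj A) ≫ T.map f = MonObj.one
  d_natural {A B : L} (f : A ⟶ B) :
    MonObj.mul (X := T.obj A) ≫ T.map f = (T.map f ⊗ₘ T.map f) ≫ MonObj.mul
  e_unit :
    MonObj.one (X := T.obj (𝟙_ L)) ≫ Functor.OplaxMonoidal.η T.toFunctor = 𝟙 (𝟙_ L)
  e_tensor (A B : L) :
    MonObj.one (X := T.obj (A ⊗ B)) ≫ Functor.OplaxMonoidal.δ T.toFunctor A B =
      (λ_ (𝟙_ L)).inv ≫ (MonObj.one (X := T.obj A) ⊗ₘ MonObj.one (X := T.obj B))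
  d_unit :
    MonObj.mul (X := T.obj (𝟙_ L)) ≫ Functor.OplaxMonoidal.η T.toFunctor =
      (Functor.OplaxMonoidal.η T.toFunctor ⊗ₘ Functor.OplaxMonoidal.η T.toFunctor) ≫
        (λ_ (𝟙_ L)).hom
  d_tensor (A B : L) :
    MonObj.mul (X := T.obj (A ⊗ B)) ≫ Functor.OplaxMonoidal.δ T.toFunctor A B =
      (Functor.OplaxMonoidal.δ T.toFunctor A B ⊗ₘ Functor.OplaxMonoidal.δ T.toFunctor A B) ≫
        tensorμ (T.obj A) (T.obj B) (T.obj A) (T.obj B) ≫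
          (MonObj.mul (X := T.obj A) ⊗ₘ MonObj.mul (X := T.obj B))
  /-- `e_A` is a morphism from the algebra `1` to the free algebra `?A`. -/
  e_algebra (A : L) :
    T.map (MonObj.one (X := T.obj A)) ≫ T.μ.app A =
      Functor.OplaxMonoidal.η T.toFunctor ≫ MonObj.one (X := T.obj A)
  /-- `d_A` is a morphism from the algebra `?A ⊗ ?A` to the free algebra `?A`. -/
  d_algebra (A : L) :
    T.map (MonObj.mul (X := T.obj A)) ≫ T.μ.app A =
      Functor.OplaxMonoidal.δ T.toFunctor (T.obj A) (T.obj A) ≫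
        (T.μ.app A ⊗ₘ T.μ.app A) ≫ MonObj.mul (X := T.obj A)
  free_hom {A B : L} (f : T.obj A ⟶ T.obj B) :
    T.map f ≫ T.μ.app B = T.μ.app A ≫ f → IsMonHom f

end Exponential

/-! ### Models of classical linear logic -/

section Classical

variable {L : Type u₁} [Category.{v₁} L] [MonoidalCategory L] [SymmetricCategory L]
  [MonoidalClosed L]

/-- The canonical map `A ⟶ (A ⊸ ⊥) ⊸ ⊥`. -/
def toDoubleDual (bot A : L) : A ⟶ (ihom ((ihom A).obj bot)).obj bot :=
  MonoidalClosed.curry ((β_ ((ihom A).obj bot) A).hom ≫ (ihom.ev A).app bot)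

/-- The contravariant functor `(-) ⊸ ⊥`. -/
@[simps]
def dual (bot : L) : Lᵒᵖ ⥤ L where
  obj A := (ihom A.unop).obj bot
  map f := (MonoidalClosed.pre f.unop).app bot

/-- The morphism `A ⟶ B ⊸ ⊥` corresponding to `f : B ⟶ A ⊸ ⊥`. -/
def dualSwap {bot A B : L} (f : B ⟶ (ihom A).obj bot) : A ⟶ (ihom B).obj bot :=
  MonoidalClosed.curry ((β_ B A).hom ≫ MonoidalClosed.uncurry f)

lemma dualSwap_dualSwap {bot A B : L} (f : B ⟶ (ihom A).obj bot) :
    dualSwap (dualSwap f) = f := by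
  simp [dualSwap]

lemma dualSwap_comp {bot A B B' : L} (g : B' ⟶ B) (f : B ⟶ (ihom A).obj bot) :
    dualSwap (g ≫ f) = dualSwap f ≫ (MonoidalClosed.pre g).app bot := by
  apply MonoidalClosed.uncurry_injective
  rw [dualSwap, MonoidalClosed.uncurry_curry, MonoidalClosed.uncurry_natural_left,
    MonoidalClosed.uncurry_pre_app, dualSwap, MonoidalClosed.uncurry_curry]
  simp

lemma dualSwap_comp_pre {bot A A' B : L} (f : B ⟶ (ihom A).obj bot) (g : A' ⟶ A) :
    dualSwap (f ≫ (MonoidalClosed.pre g).app bot) = g ≫ dualSwap f := by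
  rw [← dualSwap_dualSwap (g ≫ dualSwap f), dualSwap_comp g (dualSwap f), dualSwap_dualSwap f]

/-- The contravariant functor `(-) ⊸ ⊥` is adjoint to itself on the right. -/
def dualAdjunction (bot : L) : (dual bot).rightOp ⊣ dual bot :=
  Adjunction.mkOfHomEquiv
    { homEquiv := fun _ _ =>
        { toFun := fun f => dualSwap f.unop
          invFun := fun g => (dualSwap g).op
          left_inv := fun f => Quiver.Hom.unop_inj (dualSwap_dualSwap f.unop)
          right_inv := fun g => dualSwap_dualSwap g }
      homEquiv_naturality_left_symm := fun f g =>
        Quiver.Hom.unop_inj (dualSwap_comp f g)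
      homEquiv_naturality_right := fun f g => dualSwap_comp g.unop f.unop }

lemma dualAdjunction_unit_app (bot A : L) :
    (dualAdjunction bot).unit.app A = toDoubleDual bot A := by
  simp only [dualAdjunction, Adjunction.mkOfHomEquiv_unit_app]
  exact congrArg (fun f => MonoidalClosed.curry ((β_ ((ihom A).obj bot) A).hom ≫ f))
    (MonoidalClosed.uncurry_id_eq_ev A bot)

/-- The dual of a comonad `!`: the monad with `A ↦ (!(A ⊸ ⊥)) ⊸ ⊥`. -/
def dualMonad (bot : L) (G : Comonad L) : Monad L :=
  ((dualAdjunction bot).comp G.adj.op).toMonad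

end Classical

/-- The symmetric monoidal category `L` is a model for classical linear logic with
dualizing object `bot` and exponential `G`. -/
structure ClassicalModel (L : Type u₁) [Category.{v₁} L] [MonoidalCategory L]
    [SymmetricCategory L] (bot : L) (G : Comonad L) where
  /-- `L` is *-autonomous: symmetric monoidal closed, with dualizing object `bot`. -/
  [closed : MonoidalClosed L]
  dualizing (A : L) : IsIso (toDoubleDual bot A)
  hasFiniteProducts : HasFiniteProducts L
  hasFiniteCoproducts : HasFiniteCoproducts L
  exponential : LinearExponentialComonad G

namespace ClassicalModel

variable {L : Type u₁} [Category.{v₁} L] [MonoidalCategory L] [SymmetricCategory L]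
  {bot : L} {G : Comonad L}

/-- The dual monad `?` of `!`, with `?A = (!(A ⊸ ⊥)) ⊸ ⊥`. -/
def whynot (S : ClassicalModel L bot G) : Monad L :=
  letI := S.closed
  dualMonad bot G

/-- Currying in a model: the morphism `B ⟶ A ⊸ X` corresponding to `f : A ⊗ B ⟶ X`. -/
def curry (S : ClassicalModel L bot G) {A B X : L} (f : A ⊗ B ⟶ X) :
    B ⟶ (S.closed.closed A).rightAdj.obj X :=
  letI := S.closed
  MonoidalClosed.curry f

end ClassicalModel

end LPC

namespace LPC

/-! ### Calculus of `⅋` -/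

section Par

variable {L : Type u₁} [Category.{v₁} L] [Par L]

/-! Star-autonomy. If `A'` is dual to `A`, then `A ⊗ -` is left adjoint to `A' ⅋ -`: the unit
inserts `1 ⟶ A' ⅋ A` and distributes from the right, the counit distributes from the left and
contracts `A ⊗ A' ⟶ ⊥`. The two mixed coherence conditions slide one distribution past the other,
and so reduce the triangle identities at every object to the two zigzags (`DualPair.left_triangle`,
`DualPair.right_triangle`). With `A ⊸ B` taken to be `A^⊥ ⅋ B`, the canonical map of the statement
is an identity. Since duality is symmetric, pairings with `A^⊥` classify maps into `A` as well, and
Yoneda makes `⊥` dualizing.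

Exponentials. The left adjoint of a symmetric monoidal adjunction is automatically strong, so `F_!`
carries the natural commutative comonoids of the producing category to comonoids in `L`. The axioms
on `e` and `d` then come from their naturality and monoidality in `P`, together with monoidality of
the adjunction. A coalgebra morphism between free coalgebras is `F_!` of a morphism of `P`
(`eq_map_of_coalgebra`), hence preserves the comonoids. The dual computation treats `?`, where the
right adjoint `F_?` is strong.

Comparison of monads. The monad of an adjunction with left adjoint `F` is determined by the hom-sets
between objects `F X`, so it does not change when `F` is followed by a fully faithful functor
(`monadIsoOfFullyFaithful`). The dual monad comes from an adjunction with left adjoint `A ↦ ⌊A ⊸ ⊥⌋`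
into the opposite of `P`. The equivalence `(-)^*` turns this into `⌊A ⊸ ⊥⌋^* ≅ ⌈(A ⊸ ⊥)^⊥⌉ ≅ ⌈A⌉`,
the left adjoint defining `?`. -/

@[simp]
lemma parMap_id (A B : L) : parMap (𝟙 A) (𝟙 B) = 𝟙 (A ⅋ B) :=
  Par.monoidal.id_tensorHom_id A B

lemma parMap_comp {A A' A'' B B' B'' : L} (f : A ⟶ A') (f' : A' ⟶ A'') (g : B ⟶ B')
    (g' : B' ⟶ B'') : parMap f g ≫ parMap f' g' = parMap (f ≫ f') (g ≫ g') :=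
  Par.monoidal.tensorHom_comp_tensorHom f g f' g'

lemma parAssoc_naturality {A A' B B' C C' : L} (f : A ⟶ A') (g : B ⟶ B') (h : C ⟶ C') :
    parMap (parMap f g) h ≫ (parAssoc A' B' C').hom =
      (parAssoc A B C).hom ≫ parMap f (parMap g h) :=
  Par.monoidal.associator_naturality f g h

lemma parLeftUnitor_naturality {A A' : L} (f : A ⟶ A') :
    parMap (𝟙 (parUnit L)) f ≫ (parLeftUnitor A').hom = (parLeftUnitor A).hom ≫ f :=
  letI := Par.monoidal (L := L)
  (congrArg (· ≫ (λ_ A').hom) (id_tensorHom (𝟙_ L) f)).trans (leftUnitor_naturality f)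

lemma parRightUnitor_naturality {A A' : L} (f : A ⟶ A') :
    parMap f (𝟙 (parUnit L)) ≫ (parRightUnitor A').hom = (parRightUnitor A).hom ≫ f :=
  letI := Par.monoidal (L := L)
  (congrArg (· ≫ (ρ_ A').hom) (tensorHom_id f (𝟙_ L))).trans (rightUnitor_naturality f)

lemma par_triangle (A B : L) :
    (parAssoc A (parUnit L) B).hom ≫ parMap (𝟙 A) (parLeftUnitor B).hom =
      parMap (parRightUnitor A).hom (𝟙 B) :=
  letI := Par.monoidal (L := L)
  (congrArg ((α_ A (𝟙_ L) B).hom ≫ ·) (id_tensorHom A (λ_ B).hom)).trans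
    ((MonoidalCategory.triangle A B).trans (tensorHom_id (ρ_ A).hom B).symm)

lemma parSymm_naturality {A A' B B' : L} (f : A ⟶ A') (g : B ⟶ B') :
    parMap f g ≫ (parSymm A' B').hom = (parSymm A B).hom ≫ parMap g f :=
  letI := Par.monoidal (L := L)
  letI := Par.symmetric (L := L)
  BraidedCategory.braiding_naturality f g

@[simp]
lemma parSymm_parSymm (A B : L) : (parSymm A B).hom ≫ (parSymm B A).hom = 𝟙 (A ⅋ B) :=
  letI := Par.monoidal (L := L)
  letI := Par.symmetric (L := L)
  SymmetricCategory.symmetry A B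

@[simp]
lemma parSymm_parLeftUnitor (A : L) :
    (parSymm A (parUnit L)).hom ≫ (parLeftUnitor A).hom = (parRightUnitor A).hom :=
  letI := Par.monoidal (L := L)
  letI := Par.symmetric (L := L)
  braiding_leftUnitor A

@[simp]
lemma parSymm_parRightUnitor (A : L) :
    (parSymm (parUnit L) A).hom ≫ (parRightUnitor A).hom = (parLeftUnitor A).hom :=
  letI := Par.monoidal (L := L)
  letI := Par.symmetric (L := L)
  braiding_rightUnitor A

end Par

/-! ### Dual pairs in a symmetric linearly distributive category -/

section LinearlyDistributive

variable {L : Type u₁} [Category.{v₁} L] [MonoidalCategory L] [SymmetricCategory L] [Par L]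
  [LinearlyDistributive L]

open LinearlyDistributive

/-- The right distribution `(A ⅋ B) ⊗ C ⟶ A ⅋ (B ⊗ C)`. -/
abbrev rdist (A B C : L) : (A ⅋ B) ⊗ C ⟶ A ⅋ (B ⊗ C) := rightDistOf dist A B C

lemma rdist_naturality {A A' B B' C C' : L} (f : A ⟶ A') (g : B ⟶ B') (h : C ⟶ C') :
    (parMap f g ⊗ₘ h) ≫ rdist A' B' C' = rdist A B C ≫ parMap f (g ⊗ₘ h) := by
  simp only [rdist, rightDistOf, Category.assoc]
  rw [BraidedCategory.braiding_naturality_assoc, parMap_comp, Category.id_comp,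
    ← BraidedCategory.braiding_naturality, ← id_tensorHom, ← id_tensorHom,
    tensorHom_comp_tensorHom_assoc, parSymm_naturality]
  have e : parMap f ((h ⊗ₘ g) ≫ (β_ C' B').hom) =
      parMap f (h ⊗ₘ g) ≫ parMap (𝟙 A') (β_ C' B').hom := by rw [parMap_comp, Category.comp_id]
  rw [e, ← reassoc_of% parSymm_naturality, ← reassoc_of% dist_natural,
    tensorHom_comp_tensorHom_assoc]
  simp

lemma rdist_parUnit (A B : L) :
    rdist (parUnit L) A B ≫ (parLeftUnitor (A ⊗ B)).hom = (parLeftUnitor A).hom ▷ B := by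
  simp only [rdist, rightDistOf, Category.assoc]
  rw [parLeftUnitor_naturality, reassoc_of% parSymm_parLeftUnitor, reassoc_of% dist_parUnit,
    ← whiskerLeft_comp_assoc, parSymm_parRightUnitor, BraidedCategory.braiding_naturality_right]
  simp

/-- `A'` is a dual of `A`, by maps `A ⊗ A' ⟶ ⊥` and `1 ⟶ A' ⅋ A`. -/
structure DualPair (A A' : L) where
  ev : A ⊗ A' ⟶ parUnit L
  coev : 𝟙_ L ⟶ A' ⅋ A
  zigzag : (ρ_ A).inv ≫ A ◁ coev ≫ dist A A' A ≫ parMap ev (𝟙 A) ≫ (parLeftUnitor A).hom = 𝟙 A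
  zigzag' : (ρ_ A').inv ≫ A' ◁ (coev ≫ (parSymm A' A).hom) ≫ dist A' A A' ≫
    parMap ((β_ A' A).hom ≫ ev) (𝟙 A') ≫ (parLeftUnitor A').hom = 𝟙 A'

namespace DualPair

variable {A A' : L} (p : DualPair A A')

/-- Duality is a symmetric relation. -/
@[simps]
def swap : DualPair A' A where
  ev := (β_ A' A).hom ≫ p.ev
  coev := p.coev ≫ (parSymm A' A).hom
  zigzag := p.zigzag'
  zigzag' := by simpa using p.zigzag

/-- The map `X ⟶ A' ⅋ (A ⊗ X)`. -/
def unit (X : L) : X ⟶ A' ⅋ (A ⊗ X) := (λ_ X).inv ≫ p.coev ▷ X ≫ rdist A' A X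

/-- The map `A ⊗ (A' ⅋ X) ⟶ X`. -/
def counit (X : L) : A ⊗ (A' ⅋ X) ⟶ X :=
  dist A A' X ≫ parMap p.ev (𝟙 X) ≫ (parLeftUnitor X).hom

lemma unit_naturality {X Y : L} (f : X ⟶ Y) :
    f ≫ p.unit Y = p.unit X ≫ parMap (𝟙 A') (A ◁ f) := by
  simp only [unit, Category.assoc]
  rw [← id_tensorHom A f, ← rdist_naturality, parMap_id, id_tensorHom, ← whisker_exchange_assoc,
    leftUnitor_inv_naturality_assoc]

lemma counit_naturality {X Y : L} (f : X ⟶ Y) :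
    A ◁ parMap (𝟙 A') f ≫ p.counit Y = p.counit X ≫ f := by
  simp only [counit, Category.assoc]
  rw [← id_tensorHom, reassoc_of% dist_natural, ← parLeftUnitor_naturality, reassoc_of% parMap_comp,
    reassoc_of% parMap_comp]
  simp

/-- The transpose of a pairing, written in terms of the left distribution. -/
lemma unit_comp_parMap {X : L} (g : X ⊗ A ⟶ parUnit L) :
    p.unit X ≫ parMap (𝟙 A') ((β_ A X).hom ≫ g) ≫ (parRightUnitor A').hom =
      (ρ_ X).inv ≫ X ◁ (p.coev ≫ (parSymm A' A).hom) ≫ dist X A A' ≫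
        parMap g (𝟙 A') ≫ (parLeftUnitor A').hom := by
  simp only [unit, rdist, rightDistOf, Category.assoc]
  rw [reassoc_of% parMap_comp, SymmetricCategory.symmetry_assoc, Category.id_comp,
    ← reassoc_of% parSymm_naturality, parSymm_parRightUnitor,
    BraidedCategory.braiding_naturality_left_assoc, ← whiskerLeft_comp_assoc]
  simp

/-- The coherence `dist_rightDist` exchanges the two distributions, after which the composite is the
zigzag on `A` tensored with `X`. -/
lemma left_triangle (X : L) : A ◁ p.unit X ≫ p.counit (A ⊗ X) = 𝟙 (A ⊗ X) := by
  have h : A ◁ rdist A' A X ≫ dist A A' (A ⊗ X) =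
      (α_ A (A' ⅋ A) X).inv ≫ dist A A' A ▷ X ≫ rdist (A ⊗ A') A X := by
    rw [dist_rightDist, Iso.inv_hom_id_assoc]
  have h' : rdist (A ⊗ A') A X ≫ parMap p.ev (𝟙 (A ⊗ X)) =
      parMap p.ev (𝟙 A) ▷ X ≫ rdist (parUnit L) A X := by
    rw [← tensorHom_id, rdist_naturality, id_tensorHom_id]
  simp only [unit, counit, whiskerLeft_comp, Category.assoc]
  rw [reassoc_of% h, reassoc_of% h', rdist_parUnit]
  have z := congrArg (· ▷ X) p.zigzag
  simp only [comp_whiskerRight, id_whiskerRight] at z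
  rw [← z]
  simp

/-- The coherence `rightDist_dist` reduces the composite to the zigzag on `A'`, written with the
right distribution, joined by `⅋` to the identity of `X`. -/
lemma right_triangle (X : L) :
    p.unit (A' ⅋ X) ≫ parMap (𝟙 A') (p.counit X) = 𝟙 (A' ⅋ X) := by
  -- This is the zigzag on `A'` in the form needed: the unit at `A'` followed by contraction is the
  -- identity.
  have z := p.unit_comp_parMap ((β_ A' A).hom ≫ p.ev)
  rw [p.zigzag', SymmetricCategory.symmetry_assoc, unit] at z
  have h := rightDist_dist A' A A' X
  have hc : p.coev ▷ (A' ⅋ X) ≫ dist (A' ⅋ A) A' X =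
      dist (𝟙_ L) A' X ≫ parMap (p.coev ▷ A') (𝟙 X) := by
    rw [← tensorHom_id, ← parMap_id, dist_natural, tensorHom_id]
  have hu : (λ_ (A' ⅋ X)).inv ≫ dist (𝟙_ L) A' X = parMap (λ_ A').inv (𝟙 X) := by
    rw [Iso.inv_comp_eq, ← dist_tensorUnit, Category.assoc, parMap_comp]
    simp
  have he : parMap (𝟙 A') (p.counit X) = parMap (𝟙 A') (dist A A' X) ≫
      parMap (𝟙 A') (parMap p.ev (𝟙 X)) ≫ parMap (𝟙 A') (parLeftUnitor X).hom := by
    simp only [parMap_comp, counit, Category.comp_id]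
  rw [he, unit]
  simp only [Category.assoc]
  rw [← reassoc_of% h, reassoc_of% hc, reassoc_of% hu, ← reassoc_of% parAssoc_naturality,
    par_triangle]
  simp only [parMap_comp, Category.comp_id, Category.assoc] at z ⊢
  simp only [rdist] at z
  rw [z, parMap_id]

/-- The functor `A' ⅋ -` is right adjoint to `A ⊗ -`. -/
@[simps]
def parFunctor (A' : L) : L ⥤ L where
  obj X := A' ⅋ X
  map f := parMap (𝟙 A') f
  map_comp f g := by rw [parMap_comp, Category.comp_id]

/-- For a dual pair, `A ⊗ -` is left adjoint to `A' ⅋ -`. -/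
def adjunction : tensorLeft A ⊣ parFunctor A' :=
  Adjunction.mkOfUnitCounit
    { unit := { app := p.unit, naturality := fun _ _ f => p.unit_naturality f }
      counit := { app := p.counit, naturality := fun _ _ f => p.counit_naturality f }
      left_triangle := by
        ext X
        exact (congrArg (A ◁ p.unit X ≫ ·) (Category.id_comp _)).trans (p.left_triangle X)
      right_triangle := by
        ext X
        exact (congrArg (p.unit (A' ⅋ X) ≫ ·) (Category.id_comp _)).trans (p.right_triangle X) }

lemma counit_parUnit : p.counit (parUnit L) = A ◁ (parRightUnitor A').hom ≫ p.ev := by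
  have h : (parLeftUnitor (parUnit L)).hom = (parRightUnitor (parUnit L)).hom :=
    letI := Par.monoidal (L := L)
    unitors_equal
  rw [counit, h, parRightUnitor_naturality, reassoc_of% dist_parUnit]

/-- Maps `X ⟶ A'` correspond to pairings `A ⊗ X ⟶ ⊥`. -/
lemma whiskerLeft_comp_ev_bijective (X : L) :
    Function.Bijective (fun h : X ⟶ A' => A ◁ h ≫ p.ev) := by
  -- The inverse sends a pairing to its transpose under the adjunction, with `A' ⅋ ⊥` identified
  -- with `A'`.
  have key (h : X ⟶ A') :
      p.unit X ≫ parMap (𝟙 A') (A ◁ h ≫ p.ev) ≫ (parRightUnitor A').hom = h := by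
    have hr := (reassoc_of% p.unit_naturality (h ≫ (parRightUnitor A').inv))
      (parMap (𝟙 A') (p.counit (parUnit L)))
    rw [p.right_triangle, parMap_comp, counit_parUnit] at hr
    simp only [Category.comp_id, whiskerLeft_comp, Category.assoc,
      whiskerLeft_inv_hom_assoc] at hr
    rw [← reassoc_of% hr, Iso.inv_hom_id, Category.comp_id]
  refine ⟨fun h h' e => ?_, fun g => ⟨p.unit X ≫ parMap (𝟙 A') g ≫ (parRightUnitor A').hom, ?_⟩⟩
  · rw [← key h, ← key h']
    exact congrArg (fun g => p.unit X ≫ parMap (𝟙 A') g ≫ (parRightUnitor A').hom) e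
  · dsimp only
    rw [whiskerLeft_comp, whiskerLeft_comp, Category.assoc, Category.assoc, ← counit_parUnit,
      p.counit_naturality, reassoc_of% p.left_triangle]

end DualPair

end LinearlyDistributive

/-! ### Star-autonomy -/

section Negation

variable {L : Type u₁} [Category.{v₁} L] [MonoidalCategory L] [SymmetricCategory L] [Par L]
  [LinearlyDistributive L] [Negation L]

open LinearlyDistributive

/-- The map `A^⊥ ⊗ A ⟶ ⊥`. -/
def negCounit (A : L) : neg A ⊗ A ⟶ parUnit L := Negation.γbot A

/-- The map `1 ⟶ A^⊥ ⅋ A`. -/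
def negUnit (A : L) : 𝟙_ L ⟶ neg A ⅋ A := Negation.γone A

lemma negMap_def {A B : L} (f : A ⟶ B) :
    negMap f = (ρ_ (neg B)).inv ≫
      neg B ◁ (negUnit A ≫ parMap (𝟙 (neg A)) f ≫ (parSymm (neg A) B).hom) ≫
        dist (neg B) B (neg A) ≫ parMap (negCounit B) (𝟙 (neg A)) ≫ (parLeftUnitor (neg A)).hom :=
  rfl

/-- The dual pair given by the negation. -/
@[simps ev coev]
def negPair (A : L) : DualPair A (neg A) where
  ev := (β_ A (neg A)).hom ≫ negCounit A
  coev := negUnit A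
  zigzag := Negation.triangle A
  zigzag' := by
    rw [SymmetricCategory.symmetry_assoc]
    exact Negation.triangle_neg A

/-- Exhibits `f^⊥` as the transpose of the pairing of `A` with `B^⊥` through `f`, so that it is
characterised by its pairing with `A`. -/
lemma negMap_eq {A B : L} (f : A ⟶ B) :
    negMap f = (negPair A).unit (neg B) ≫ parMap (𝟙 (neg A)) (f ▷ neg B ≫ (negPair B).ev) ≫
      (parRightUnitor (neg A)).hom := by
  have h : f ▷ neg B ≫ (negPair B).ev =
      (β_ A (neg B)).hom ≫ neg B ◁ f ≫ negCounit B := by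
    simp
  have hd : neg B ◁ parMap f (𝟙 (neg A)) ≫ dist (neg B) B (neg A) =
      dist (neg B) A (neg A) ≫ parMap (neg B ◁ f) (𝟙 (neg A)) := by
    rw [← id_tensorHom, dist_natural, id_tensorHom]
  rw [h, (negPair A).unit_comp_parMap, negMap_def, parSymm_naturality]
  simp only [whiskerLeft_comp, Category.assoc]
  rw [reassoc_of% hd, reassoc_of% parMap_comp, Category.comp_id, negPair_coev]

variable (L) in
/-- The closed structure with `A ⊸ B = A^⊥ ⅋ B`. -/
@[reducible]
def parClosed : MonoidalClosed L where
  closed A := { rightAdj := DualPair.parFunctor (neg A), adj := (negPair A).adjunction }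

attribute [local instance] parClosed

/-- The evaluation is by definition the counit of the adjunction chosen for `A ⊸ -`, so its
transpose is an identity. -/
lemma curry_negEval (A B : L) : MonoidalClosed.curry (negEval A B) = 𝟙 (neg A ⅋ B) :=
  (congrArg MonoidalClosed.curry (MonoidalClosed.uncurry_id_eq_ev A B)).symm.trans
    (MonoidalClosed.curry_uncurry (𝟙 ((ihom A).obj B)))

/-- The isomorphism `A ⊸ ⊥ ≅ A^⊥`. -/
def ihomParUnitIso (A : L) : (ihom A).obj (parUnit L) ≅ neg A := parRightUnitor (neg A)

lemma ihom_ev_app_parUnit (A : L) :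
    (ihom.ev A).app (parUnit L) = A ◁ (ihomParUnitIso A).hom ≫ (negPair A).ev :=
  (negPair A).counit_parUnit

/-- Maps into `A^⊥` are determined by their pairing with `A`, and both sides pair by applying `f`
and then evaluating at `B`. -/
lemma pre_comp_ihomParUnitIso {A B : L} (f : A ⟶ B) :
    (MonoidalClosed.pre f).app (parUnit L) ≫ (ihomParUnitIso A).hom =
      (ihomParUnitIso B).hom ≫ negMap f := by
  have inj := ((negPair A).whiskerLeft_comp_ev_bijective ((ihom B).obj (parUnit L))).1
  have h (X : L) (g : A ⊗ X ⟶ parUnit L) :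
      A ◁ ((negPair A).unit X ≫ parMap (𝟙 (neg A)) g ≫ (parRightUnitor (neg A)).hom) ≫
        (negPair A).ev = g := by
    rw [whiskerLeft_comp, whiskerLeft_comp, Category.assoc, Category.assoc,
      ← (negPair A).counit_parUnit, (negPair A).counit_naturality,
      reassoc_of% (negPair A).left_triangle]
  apply inj
  dsimp only
  rw [whiskerLeft_comp, Category.assoc, ← ihom_ev_app_parUnit,
    MonoidalClosed.id_tensor_pre_app_comp_ev, whiskerLeft_comp, negMap_eq, Category.assoc, h,
    ihom_ev_app_parUnit, whisker_exchange_assoc]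

/-- The unit `⊥` of `⅋` is dualizing. -/
lemma isIso_toDoubleDual (A : L) : IsIso (toDoubleDual (parUnit L) A) := by
  apply isIso_of_yoneda_map_bijective
  intro X
  let D := (ihom A).obj (parUnit L)
  let r : D ≅ neg A := ihomParUnitIso A
  -- Under this bijection, composition with the double dual map becomes the correspondence between
  -- maps `X ⟶ A` and pairings `A^⊥ ⊗ X ⟶ ⊥` given by the swapped dual pair.
  let e : (neg A ⊗ X ⟶ parUnit L) ≃ (X ⟶ (ihom D).obj (parUnit L)) :=
    (Iso.homCongr (whiskerRightIso r.symm X) (Iso.refl _)).trans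
      ((ihom.adjunction D).homEquiv X (parUnit L))
  have key (h : X ⟶ A) : h ≫ toDoubleDual (parUnit L) A = e (neg A ◁ h ≫ (negPair A).swap.ev) := by
    have : e (neg A ◁ h ≫ (negPair A).swap.ev) =
        MonoidalClosed.curry (r.hom ▷ X ≫ neg A ◁ h ≫ (negPair A).swap.ev) := by
      change MonoidalClosed.curry (_ ≫ _ ≫ 𝟙 _) = _
      rw [Category.comp_id]
      rfl
    rw [this, toDoubleDual, ← MonoidalClosed.curry_natural_left, ihom_ev_app_parUnit,
      ← whisker_exchange_assoc]
    simp [r, D]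
  rw [show (fun h : X ⟶ A => h ≫ toDoubleDual (parUnit L) A) =
    e ∘ fun h => neg A ◁ h ≫ (negPair A).swap.ev from funext key]
  exact e.bijective.comp ((negPair A).swap.whiskerLeft_comp_ev_bijective X)

/-- The double dual map is the unit of the self-adjunction of `(-) ⊸ ⊥`. -/
lemma toDoubleDual_naturality {A B : L} (f : A ⟶ B) :
    f ≫ toDoubleDual (parUnit L) B = toDoubleDual (parUnit L) A ≫
      (MonoidalClosed.pre ((MonoidalClosed.pre f).app (parUnit L))).app (parUnit L) := by
  rw [← dualAdjunction_unit_app, ← dualAdjunction_unit_app]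
  exact (dualAdjunction (parUnit L)).unit.naturality f

/-- The double dual isomorphism in the form `(A ⊸ ⊥)^⊥ ≅ A`, naturally in `A`. -/
lemma exists_neg_ihom_iso :
    ∃ e : ∀ A : L, neg ((ihom A).obj (parUnit L)) ≅ A, ∀ {A B : L} (f : A ⟶ B),
      negMap ((MonoidalClosed.pre f).app (parUnit L)) ≫ (e B).hom = (e A).hom ≫ f := by
  have := isIso_toDoubleDual (L := L)
  -- The isomorphism is `(A ⊸ ⊥)^⊥ ≅ (A ⊸ ⊥) ⊸ ⊥ ≅ A`.
  refine ⟨fun A => (ihomParUnitIso _).symm ≪≫ (asIso (toDoubleDual (parUnit L) A)).symm,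
    fun {A B} f => ?_⟩
  have n := pre_comp_ihomParUnitIso ((MonoidalClosed.pre f).app (parUnit L))
  rw [← Iso.inv_comp_eq, ← Category.assoc, ← Iso.eq_comp_inv] at n
  simp only [Iso.trans_hom, Iso.symm_hom, asIso_inv, Category.assoc]
  rw [← reassoc_of% n]
  congr 1
  rw [IsIso.comp_inv_eq, Category.assoc, toDoubleDual_naturality, IsIso.inv_hom_id_assoc]

end Negation

open Functor.LaxMonoidal Functor.OplaxMonoidal Functor.Monoidal

/-! ### The linear exponential comonad of a symmetric monoidal adjunction -/

/-- Coalgebra morphisms between free coalgebras come from the domain of the left adjoint. -/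
lemma eq_map_of_coalgebra {P : Type u₁} [Category.{v₁} P] {L : Type u₂} [Category.{v₂} L]
    {F : P ⥤ L} {G : L ⥤ P} (adj : F ⊣ G) {A B : L} (f : F.obj (G.obj A) ⟶ F.obj (G.obj B))
    (hf : F.map (adj.unit.app (G.obj A)) ≫ F.map (G.map f) =
      f ≫ F.map (adj.unit.app (G.obj B))) :
    f = F.map (adj.unit.app (G.obj A) ≫ G.map f ≫ G.map (adj.counit.app B)) := by
  -- The coalgebra condition moves `f` to the front, and what follows it cancels by the triangle
  -- identity at `B`.
  rw [F.map_comp, F.map_comp, reassoc_of% hf, ← F.map_comp, adj.right_triangle_components,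
    F.map_id, Category.comp_id]

section Comonad

variable {P : Type u₁} [Category.{v₁} P] [MonoidalCategory P] [SymmetricCategory P]
  {L : Type u₂} [Category.{v₂} L] [MonoidalCategory L] [SymmetricCategory L]

namespace IsMonoidalAdjunction

variable {F : P ⥤ L} {G : L ⥤ P} [F.LaxBraided] [G.LaxBraided] {adj : F ⊣ G}

lemma ε_comp_map_ε (h : IsMonoidalAdjunction adj) :
    ε G ≫ G.map (ε F) = adj.unit.app (𝟙_ P) := by
  simpa using h.unit.unit.symm

lemma μ_comp_map_μ (h : IsMonoidalAdjunction adj) (X Y : P) :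
    (adj.unit.app X ⊗ₘ adj.unit.app Y) ≫ μ G (F.obj X) (F.obj Y) ≫ G.map (μ F X Y) =
      adj.unit.app (X ⊗ Y) := by
  simpa using (h.unit.tensor X Y).symm

lemma ε_comp_counit (h : IsMonoidalAdjunction adj) :
    ε F ≫ F.map (ε G) ≫ adj.counit.app (𝟙_ L) = 𝟙 (𝟙_ L) := by
  simpa using h.counit.unit

lemma μ_comp_counit (h : IsMonoidalAdjunction adj) (A B : L) :
    μ F (G.obj A) (G.obj B) ≫ F.map (μ G A B) ≫ adj.counit.app (A ⊗ B) =
      adj.counit.app A ⊗ₘ adj.counit.app B := by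
  simpa using h.counit.tensor A B

/-- The left adjoint of a symmetric monoidal adjunction is strong monoidal. -/
@[reducible]
noncomputable def leftAdjointBraided (h : IsMonoidalAdjunction adj) : F.Braided :=
  -- The inverses of `ε F` and `μ F` are the mates of the lax structure of `G`. Monoidality of the
  -- counit gives one composite, monoidality of the unit with a triangle identity the other.
  haveI : IsIso (ε F) := ⟨F.map (ε G) ≫ adj.counit.app (𝟙_ L), h.ε_comp_counit, by
    rw [Category.assoc, ← adj.counit_naturality, ← F.map_comp_assoc, h.ε_comp_map_ε]
    exact adj.left_triangle_components _⟩
  haveI (X Y : P) : IsIso (μ F X Y) :=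
    ⟨F.map ((adj.unit.app X ⊗ₘ adj.unit.app Y) ≫ μ G _ _) ≫ adj.counit.app _, by
      rw [F.map_comp, Category.assoc, ← μ_natural_assoc]
      refine (congrArg (_ ≫ ·) (h.μ_comp_counit (F.obj X) (F.obj Y))).trans ?_
      simp, by
      rw [Category.assoc, ← adj.counit_naturality, ← F.map_comp_assoc, Category.assoc,
        h.μ_comp_map_μ]
      exact adj.left_triangle_components _⟩
  { Functor.Monoidal.ofLaxMonoidal F with
    braided := Functor.LaxBraided.braided }

/-- The comultiplication is `F` of the unit at `G A`, so naturality of the unit along `ε G` and `μ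
G` and its monoidality suffice. -/
lemma comul_monoidal (h : IsMonoidalAdjunction adj) :
    NatTrans.IsMonoidal (F₁ := G ⋙ F) (F₂ := (G ⋙ F) ⋙ (G ⋙ F)) adj.toComonad.δ where
  unit := by
    change (ε F ≫ F.map (ε G)) ≫ F.map (adj.unit.app (G.obj (𝟙_ L))) =
      (ε F ≫ F.map (ε G)) ≫ F.map (G.map (ε F ≫ F.map (ε G)))
    have n := adj.unit_naturality (ε G)
    rw [Category.assoc, Category.assoc, ← F.map_comp, ← F.map_comp, ← n, G.map_comp,
      ← h.ε_comp_map_ε, Category.assoc]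
  tensor A B := by
    change (μ F _ _ ≫ F.map (μ G A B)) ≫ F.map (adj.unit.app (G.obj (A ⊗ B))) =
      (F.map (adj.unit.app (G.obj A)) ⊗ₘ F.map (adj.unit.app (G.obj B))) ≫
        (μ F _ _ ≫ F.map (μ G _ _)) ≫ F.map (G.map (μ F _ _ ≫ F.map (μ G A B)))
    have n := adj.unit_naturality (μ G A B)
    rw [Category.assoc, Category.assoc, μ_natural_assoc, ← F.map_comp, ← F.map_comp,
      ← F.map_comp, ← n, G.map_comp, ← h.μ_comp_map_μ, Category.assoc, Category.assoc]
    rfl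

end IsMonoidalAdjunction

section

variable [NaturalComonoids P] (F : P ⥤ L) [F.Braided]

/-- The counit of the comonoid `F X`. -/
def mapCounit (X : P) : F.obj X ⟶ 𝟙_ L := F.map ComonObj.counit ≫ η F

/-- The comultiplication of the comonoid `F X`. -/
def mapComul (X : P) : F.obj X ⟶ F.obj X ⊗ F.obj X := F.map ComonObj.comul ≫ δ F X X

lemma map_comp_mapCounit {X Y : P} (f : X ⟶ Y) : F.map f ≫ mapCounit F Y = mapCounit F X := by
  rw [mapCounit, ← F.map_comp_assoc, NaturalComonoids.e_natural, mapCounit]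

lemma map_comp_mapComul {X Y : P} (f : X ⟶ Y) :
    F.map f ≫ mapComul F Y = mapComul F X ≫ (F.map f ⊗ₘ F.map f) := by
  rw [mapComul, ← F.map_comp_assoc, NaturalComonoids.d_natural, mapComul, Category.assoc,
    δ_natural, F.map_comp_assoc]

lemma mapComul_braiding (X : P) : mapComul F X ≫ (β_ (F.obj X) (F.obj X)).hom = mapComul F X := by
  have h : δ F X X ≫ (β_ (F.obj X) (F.obj X)).hom = F.map (β_ X X).hom ≫ δ F X X := by simp
  rw [mapComul, Category.assoc, h, ← F.map_comp_assoc, IsCommComonObj.comul_comm]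

lemma ε_comp_mapCounit : ε F ≫ mapCounit F (𝟙_ P) = 𝟙 (𝟙_ L) := by
  rw [mapCounit, NaturalComonoids.e_unit]
  simp

lemma μ_comp_mapCounit (X Y : P) : μ F X Y ≫ mapCounit F (X ⊗ Y) =
    (mapCounit F X ⊗ₘ mapCounit F Y) ≫ (λ_ (𝟙_ L)).hom := by
  rw [mapCounit, NaturalComonoids.e_tensor, mapCounit, mapCounit, ← tensorHom_comp_tensorHom,
    Category.assoc, F.map_comp, Category.assoc, ← μ_natural_assoc, map_leftUnitor,
    MonoidalCategory.tensorHom_def (η F)]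
  simp only [Category.assoc, μ_δ_assoc, leftUnitor_naturality]

lemma ε_comp_mapComul : ε F ≫ mapComul F (𝟙_ P) = (λ_ (𝟙_ L)).inv ≫ (ε F ⊗ₘ ε F) := by
  rw [mapComul, NaturalComonoids.d_unit, map_leftUnitor_inv, MonoidalCategory.tensorHom_def']
  simp

/-- After composition with the invertible `μ F`, this is `d_tensor` in `P` combined with the fact
that a braided functor preserves the middle interchange `tensorμ`. -/
lemma μ_comp_mapComul (X Y : P) : μ F X Y ≫ mapComul F (X ⊗ Y) =
    (mapComul F X ⊗ₘ mapComul F Y) ≫ tensorμ _ _ _ _ ≫ (μ F X Y ⊗ₘ μ F X Y) := by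
  rw [← cancel_mono (μ F (X ⊗ Y) (X ⊗ Y))]
  simp only [Category.assoc, mapComul, δ_μ, Category.comp_id]
  rw [tensorμ_comp_μ_tensorHom_μ_comp_μ, tensorHom_comp_tensorHom_assoc,
    NaturalComonoids.d_tensor]
  simp

variable {F} {G : L ⥤ P} [G.LaxBraided] {adj : F ⊣ G}

namespace IsMonoidalAdjunction

/-- `F X` is a coalgebra by `F` of the unit, and this makes its counit a coalgebra morphism. The
unit at `1` is built from `ε G` and `ε F`, and the latter cancels against `η F`. -/
lemma map_unit_comp_mapCounit (h : IsMonoidalAdjunction adj) (X : P) :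
    F.map (adj.unit.app X) ≫ F.map (G.map (mapCounit F X)) =
      mapCounit F X ≫ ε F ≫ F.map (ε G) := by
  have n := adj.unit_naturality (ComonObj.counit (X := X))
  rw [mapCounit, G.map_comp, ← F.map_comp, reassoc_of% n, ← h.ε_comp_map_ε, Category.assoc,
    Category.assoc, η_ε_assoc, ← F.map_comp, ← G.map_comp, ε_η, G.map_id, Category.comp_id]

lemma map_unit_comp_mapComul (h : IsMonoidalAdjunction adj) (X : P) :
    F.map (adj.unit.app X) ≫ F.map (G.map (mapComul F X)) =
      mapComul F X ≫ (F.map (adj.unit.app X) ⊗ₘ F.map (adj.unit.app X)) ≫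
        μ F _ _ ≫ F.map (μ G _ _) := by
  have n := adj.unit_naturality (ComonObj.comul (X := X))
  rw [mapComul, G.map_comp, ← F.map_comp, reassoc_of% n, ← h.μ_comp_map_μ, Category.assoc,
    Category.assoc, ← G.map_comp, μ_δ, μ_natural_assoc, Category.assoc, δ_μ_assoc, G.map_id,
    Category.comp_id, ← F.map_comp, ← F.map_comp]

end IsMonoidalAdjunction

/-- The comonad of a symmetric monoidal adjunction with a category of natural commutative comonoids
is a linear exponential comonad. -/
def IsMonoidalAdjunction.linearExponentialComonad (h : IsMonoidalAdjunction adj) :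
    LinearExponentialComonad adj.toComonad :=
  -- The structure maps of this comonoid are definitionally `mapCounit` and `mapComul`.
  letI (A : L) : ComonObj (adj.toComonad.obj A) := Functor.obj.instComonObj (G.obj A) F
  { lax := inferInstanceAs (G ⋙ F).LaxBraided
    ε_monoidal := h.counit
    δ_monoidal := h.comul_monoidal
    comonoid := inferInstance
    commutative := fun A => ⟨mapComul_braiding F (G.obj A)⟩
    e_natural := fun f => map_comp_mapCounit F (G.map f)
    d_natural := fun f => map_comp_mapComul F (G.map f)
    e_unit := by
      change (ε F ≫ F.map (ε G)) ≫ mapCounit F (G.obj _) = _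
      rw [Category.assoc, map_comp_mapCounit, ε_comp_mapCounit]
    e_tensor := fun A B => by
      change (μ F _ _ ≫ F.map (μ G A B)) ≫ mapCounit F (G.obj _) =
        (mapCounit F _ ⊗ₘ mapCounit F _) ≫ _
      rw [Category.assoc, map_comp_mapCounit, μ_comp_mapCounit]
    d_unit := by
      change (ε F ≫ F.map (ε G)) ≫ mapComul F (G.obj _) =
        _ ≫ (ε F ≫ F.map (ε G) ⊗ₘ ε F ≫ F.map (ε G))
      rw [Category.assoc, map_comp_mapComul, reassoc_of% ε_comp_mapComul, tensorHom_comp_tensorHom]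
    d_tensor := fun A B => by
      change (μ F _ _ ≫ F.map (μ G A B)) ≫ mapComul F (G.obj _) =
        (mapComul F _ ⊗ₘ mapComul F _) ≫ tensorμ _ _ _ _ ≫
          (μ F _ _ ≫ F.map (μ G A B) ⊗ₘ μ F _ _ ≫ F.map (μ G A B))
      rw [Category.assoc, map_comp_mapComul, reassoc_of% μ_comp_mapComul, tensorHom_comp_tensorHom]
    e_coalgebra := fun A => h.map_unit_comp_mapCounit (G.obj A)
    d_coalgebra := fun A => h.map_unit_comp_mapComul (G.obj A)
    -- Once `f` is an image under `F`, naturality of `e` and `d` in `P` is all that is needed.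
    free_hom := fun {A B} f hf => by
      rw [eq_map_of_coalgebra adj f hf]
      exact ⟨map_comp_mapCounit F _, map_comp_mapComul F _⟩ }

end

end Comonad

/-! ### The linear exponential monad of a symmetric comonoidal adjunction -/

/-- Algebra morphisms between free algebras come from the codomain of the left adjoint. -/
lemma eq_map_of_algebra {C : Type u₁} [Category.{v₁} C] {L : Type u₂} [Category.{v₂} L]
    {F : L ⥤ C} {G : C ⥤ L} (adj : F ⊣ G) {A B : L} (f : G.obj (F.obj A) ⟶ G.obj (F.obj B))
    (hf : G.map (F.map f) ≫ G.map (adj.counit.app (F.obj B)) =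
      G.map (adj.counit.app (F.obj A)) ≫ f) :
    f = G.map (F.map (adj.unit.app A) ≫ F.map f ≫ adj.counit.app (F.obj B)) := by
  rw [G.map_comp, G.map_comp, hf, ← G.map_comp_assoc]
  refine (Category.id_comp f).symm.trans (congrArg (· ≫ f) ?_)
  exact ((congrArg G.map (adj.left_triangle_components A)).trans (G.map_id _)).symm

section Monad

variable {C : Type u₁} [Category.{v₁} C] [MonoidalCategory C]
  {L : Type u₂} [Category.{v₂} L] [MonoidalCategory L]

namespace IsComonoidal

variable {F : L ⥤ C} {G : C ⥤ L} [F.OplaxMonoidal] [G.OplaxMonoidal] {adj : F ⊣ G}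

lemma unit_comp_map_η (hu : IsComonoidal adj.unit) :
    adj.unit.app (𝟙_ L) ≫ G.map (η F) ≫ η G = 𝟙 (𝟙_ L) := by
  simpa using hu.unit

lemma unit_comp_map_δ (hu : IsComonoidal adj.unit) (A B : L) :
    adj.unit.app (A ⊗ B) ≫ G.map (δ F A B) ≫ δ G (F.obj A) (F.obj B) =
      adj.unit.app A ⊗ₘ adj.unit.app B := by
  simpa using hu.tensor A B

lemma counit_app_tensorUnit (hc : IsComonoidal adj.counit) :
    adj.counit.app (𝟙_ C) = F.map (η G) ≫ η F := by
  simpa using hc.unit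

lemma counit_app_tensorObj (hc : IsComonoidal adj.counit) (X Y : C) :
    adj.counit.app (X ⊗ Y) = F.map (δ G X Y) ≫ δ F (G.obj X) (G.obj Y) ≫
      (adj.counit.app X ⊗ₘ adj.counit.app Y) := by
  simpa using hc.tensor X Y

lemma mul_comonoidal (hc : IsComonoidal adj.counit) :
    IsComonoidal (F := (F ⋙ G) ⋙ (F ⋙ G)) (G := F ⋙ G) adj.toMonad.μ where
  unit := by
    change G.map (adj.counit.app (F.obj (𝟙_ L))) ≫ G.map (η F) ≫ η G =
      G.map (F.map (G.map (η F) ≫ η G)) ≫ G.map (η F) ≫ η G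
    have n := adj.counit_naturality (η F)
    rw [← G.map_comp_assoc, ← G.map_comp_assoc, ← n, hc.counit_app_tensorUnit, F.map_comp,
      Category.assoc]
  tensor A B := by
    change G.map (adj.counit.app (F.obj (A ⊗ B))) ≫ G.map (δ F A B) ≫ δ G _ _ =
      (G.map (F.map (G.map (δ F A B) ≫ δ G _ _)) ≫ G.map (δ F _ _) ≫ δ G _ _) ≫
        (G.map (adj.counit.app (F.obj A)) ⊗ₘ G.map (adj.counit.app (F.obj B)))
    have n := adj.counit_naturality (δ F A B)
    rw [Category.assoc, Category.assoc, δ_natural, ← G.map_comp_assoc, ← G.map_comp_assoc,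
      ← G.map_comp_assoc, ← n, hc.counit_app_tensorObj, F.map_comp, Category.assoc]
    simp only [Category.assoc]
    rfl

end IsComonoidal

variable [SymmetricCategory C] [SymmetricCategory L]

/-- The right adjoint of a symmetric comonoidal adjunction is strong monoidal. -/
@[reducible]
noncomputable def IsComonoidalAdjunction.rightAdjointBraided {F : L ⥤ C} {G : C ⥤ L}
    [SymmetricComonoidal F] [SymmetricComonoidal G] {adj : F ⊣ G}
    (h : IsComonoidalAdjunction adj) : G.Braided :=
  -- Dually to the monoidal case, the inverses of `η G` and `δ G` are the mates of the oplax
  -- structure of `F`.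
  haveI : IsIso (η G) := ⟨adj.unit.app (𝟙_ L) ≫ G.map (η F), by
    have n := adj.unit_naturality (η G)
    rw [← reassoc_of% n, ← G.map_comp, ← h.counit.counit_app_tensorUnit]
    exact adj.right_triangle_components _, by
    rw [Category.assoc]
    exact h.unit.unit_comp_map_η⟩
  haveI (X Y : C) : IsIso (δ G X Y) :=
    ⟨adj.unit.app (G.obj X ⊗ G.obj Y) ≫
      G.map (δ F _ _ ≫ (adj.counit.app X ⊗ₘ adj.counit.app Y)), by
      have n := adj.unit_naturality (δ G X Y)
      rw [← reassoc_of% n, ← G.map_comp, ← h.counit.counit_app_tensorObj]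
      exact adj.right_triangle_components _, by
      rw [G.map_comp, Category.assoc, Category.assoc, ← δ_natural]
      refine (congrArg (fun f => adj.unit.app _ ≫ G.map (δ F _ _) ≫ f) rfl).trans ?_
      have n := h.unit.unit_comp_map_δ (G.obj X) (G.obj Y)
      rw [reassoc_of% n, tensorHom_comp_tensorHom, adj.right_triangle_components,
        adj.right_triangle_components, id_tensorHom_id]⟩
  { Functor.Monoidal.ofOplaxMonoidal G with
    braided := fun X Y => by
      change inv (δ G X Y) ≫ _ = _ ≫ inv (δ G Y X)
      rw [IsIso.inv_comp_eq, ← Category.assoc, IsIso.eq_comp_inv, SymmetricComonoidal.braided] }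

section

variable [NaturalMonoids C] (G : C ⥤ L) [G.Braided]

/-- The unit of the monoid `G X`. -/
def mapOne (X : C) : 𝟙_ L ⟶ G.obj X := ε G ≫ G.map MonObj.one

/-- The multiplication of the monoid `G X`. -/
def mapMul (X : C) : G.obj X ⊗ G.obj X ⟶ G.obj X := μ G X X ≫ G.map MonObj.mul

lemma mapOne_comp_map {X Y : C} (f : X ⟶ Y) : mapOne G X ≫ G.map f = mapOne G Y := by
  rw [mapOne, Category.assoc, ← G.map_comp, NaturalMonoids.e_natural, mapOne]

lemma mapMul_comp_map {X Y : C} (f : X ⟶ Y) :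
    mapMul G X ≫ G.map f = (G.map f ⊗ₘ G.map f) ≫ mapMul G Y := by
  rw [mapMul, Category.assoc, ← G.map_comp, NaturalMonoids.d_natural, mapMul, μ_natural_assoc,
    G.map_comp]

lemma braiding_mapMul (X : C) : (β_ (G.obj X) (G.obj X)).hom ≫ mapMul G X = mapMul G X := by
  rw [mapMul, ← Functor.LaxBraided.braided_assoc, ← G.map_comp, IsCommMonObj.mul_comm]

lemma mapOne_comp_η : mapOne G (𝟙_ C) ≫ η G = 𝟙 (𝟙_ L) := by
  rw [mapOne, NaturalMonoids.e_unit]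
  simp

lemma mapOne_comp_δ (X Y : C) : mapOne G (X ⊗ Y) ≫ δ G X Y =
    (λ_ (𝟙_ L)).inv ≫ (mapOne G X ⊗ₘ mapOne G Y) := by
  rw [mapOne, NaturalMonoids.e_tensor, mapOne, mapOne, ← tensorHom_comp_tensorHom,
    Category.assoc, G.map_comp, Category.assoc, ← δ_natural, map_leftUnitor_inv,
    MonoidalCategory.tensorHom_def' (ε G)]
  simp only [Category.assoc, μ_δ_assoc, leftUnitor_inv_naturality_assoc]

lemma mapMul_comp_η : mapMul G (𝟙_ C) ≫ η G = (η G ⊗ₘ η G) ≫ (λ_ (𝟙_ L)).hom := by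
  rw [mapMul, NaturalMonoids.d_unit, map_leftUnitor, MonoidalCategory.tensorHom_def]
  simp

/-- Precomposing with the invertible `μ G` reduces this to `d_tensor` in `C` and preservation of
`tensorμ`. -/
lemma mapMul_comp_δ (X Y : C) : mapMul G (X ⊗ Y) ≫ δ G X Y =
    (δ G X Y ⊗ₘ δ G X Y) ≫ tensorμ _ _ _ _ ≫ (mapMul G X ⊗ₘ mapMul G Y) := by
  rw [← cancel_epi (μ G X Y ⊗ₘ μ G X Y), tensorHom_comp_tensorHom_assoc, μ_δ, id_tensorHom_id,
    Category.id_comp, mapMul, NaturalMonoids.d_tensor, G.map_comp, Category.assoc,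
    Category.assoc, ← tensorμ_comp_μ_tensorHom_μ_comp_μ_assoc,
    ← δ_natural, μ_δ_assoc, tensorHom_comp_tensorHom, mapMul, mapMul]

/-- The composite of a symmetric comonoidal functor and a braided one. -/
@[reducible]
def SymmetricComonoidal.compBraided (F : L ⥤ C) [SymmetricComonoidal F] (G : C ⥤ L) [G.Braided] :
    SymmetricComonoidal (F ⋙ G) where
  braided A B := by
    change G.map (F.map (β_ A B).hom) ≫ G.map (δ F B A) ≫ δ G _ _ =
      (G.map (δ F A B) ≫ δ G _ _) ≫ _
    rw [← G.map_comp_assoc, SymmetricComonoidal.braided, G.map_comp, G.map_braiding]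
    simp

variable {F : L ⥤ C} {G} [SymmetricComonoidal F] {adj : F ⊣ G}

/-- `G X` is an algebra by `G` of the counit, and this makes its unit an algebra morphism: the
counit at `⊥` is built from `η G` and `η F`, and `ε G` cancels `η G`. -/
lemma map_mapOne_comp_counit (hc : IsComonoidal adj.counit) (X : C) :
    G.map (F.map (mapOne G X)) ≫ G.map (adj.counit.app X) =
      (G.map (η F) ≫ η G) ≫ mapOne G X := by
  have n := adj.counit_naturality (MonObj.one (X := X))
  rw [mapOne, F.map_comp, ← G.map_comp, Category.assoc, n, hc.counit_app_tensorUnit,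
    Category.assoc, Category.assoc, η_ε_assoc, ← F.map_comp_assoc, ε_η, F.map_id,
    Category.id_comp, G.map_comp]

lemma map_mapMul_comp_counit (hc : IsComonoidal adj.counit) (X : C) :
    G.map (F.map (mapMul G X)) ≫ G.map (adj.counit.app X) =
      (G.map (δ F _ _) ≫ δ G _ _) ≫
        (G.map (adj.counit.app X) ⊗ₘ G.map (adj.counit.app X)) ≫ mapMul G X := by
  have n := adj.counit_naturality (MonObj.mul (X := X))
  rw [mapMul, F.map_comp, ← G.map_comp, Category.assoc, n, hc.counit_app_tensorObj,
    Category.assoc, Category.assoc, Category.assoc, δ_natural_assoc]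
  dsimp only [Functor.id_obj]
  rw [δ_μ_assoc, ← F.map_comp_assoc, μ_δ, F.map_id,
    Category.id_comp, G.map_comp, G.map_comp]

/-- The monad of a symmetric comonoidal adjunction with a category of natural commutative monoids
is a linear exponential monad. -/
def IsComonoidal.linearExponentialMonad (hu : IsComonoidal adj.unit)
    (hc : IsComonoidal adj.counit) : LinearExponentialMonad adj.toMonad :=
  letI (A : L) : MonObj (adj.toMonad.obj A) := Functor.monObjObj (F := G) (X := F.obj A)
  { oplax := SymmetricComonoidal.compBraided F G
    η_comonoidal := hu
    μ_comonoidal := hc.mul_comonoidal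
    monoid := inferInstance
    commutative := fun A => ⟨braiding_mapMul G (F.obj A)⟩
    e_natural := fun f => mapOne_comp_map G (F.map f)
    d_natural := fun f => mapMul_comp_map G (F.map f)
    e_unit := by
      change mapOne G (F.obj _) ≫ G.map (η F) ≫ η G = _
      rw [reassoc_of% mapOne_comp_map, mapOne_comp_η]
    e_tensor := fun A B => by
      change mapOne G (F.obj _) ≫ G.map (δ F A B) ≫ δ G _ _ =
        _ ≫ (mapOne G (F.obj A) ⊗ₘ mapOne G (F.obj B))
      rw [reassoc_of% mapOne_comp_map, mapOne_comp_δ]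
    d_unit := by
      change mapMul G (F.obj _) ≫ G.map (η F) ≫ η G =
        (G.map (η F) ≫ η G ⊗ₘ G.map (η F) ≫ η G) ≫ _
      rw [reassoc_of% mapMul_comp_map, mapMul_comp_η, tensorHom_comp_tensorHom_assoc]
    d_tensor := fun A B => by
      change mapMul G (F.obj _) ≫ G.map (δ F A B) ≫ δ G _ _ =
        (G.map (δ F A B) ≫ δ G _ _ ⊗ₘ G.map (δ F A B) ≫ δ G _ _) ≫ tensorμ _ _ _ _ ≫
          (mapMul G (F.obj A) ⊗ₘ mapMul G (F.obj B))
      rw [reassoc_of% mapMul_comp_map, mapMul_comp_δ, tensorHom_comp_tensorHom_assoc]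
    e_algebra := fun A => map_mapOne_comp_counit hc (F.obj A)
    d_algebra := fun A => map_mapMul_comp_counit hc (F.obj A)
    free_hom := fun {A B} f hf => by
      rw [eq_map_of_algebra adj f hf]
      exact ⟨mapOne_comp_map G _, mapMul_comp_map G _⟩ }

end

end Monad

/-! ### Isomorphisms of monads from functors between the codomains of left adjoints -/

section MonadIso

variable {A : Type u₁} [Category.{v₁} A] {B : Type u₂} [Category.{v₂} B]
  {B' : Type u₃} [Category.{v₃} B'] {F : A ⥤ B} {G : B ⥤ A} {F' : A ⥤ B'} {G' : B' ⥤ A}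

/-- The comparison `G F X ⟶ G' F' X` of the monads of two adjunctions. -/
def monadComparison (adj : F ⊣ G) (adj' : F' ⊣ G') (K : B ⥤ B') (e : F ⋙ K ≅ F') (X : A) :
    G.obj (F.obj X) ⟶ G'.obj (F'.obj X) :=
  adj'.homEquiv _ _ (e.inv.app _ ≫ K.map (adj.counit.app (F.obj X)) ≫ e.hom.app X)

/-- The inverse comparison, when `K` is fully faithful. -/
def monadComparisonInv (adj : F ⊣ G) (adj' : F' ⊣ G') {K : B ⥤ B'} (hK : K.FullyFaithful)
    (e : F ⋙ K ≅ F') (X : A) : G'.obj (F'.obj X) ⟶ G.obj (F.obj X) :=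
  adj.homEquiv _ _ (hK.preimage (e.hom.app _ ≫ adj'.counit.app (F'.obj X) ≫ e.inv.app X))

section

variable (adj : F ⊣ G) (adj' : F' ⊣ G') {K : B ⥤ B'} (hK : K.FullyFaithful) (e : F ⋙ K ≅ F')

/-- Characterises the comparison by its transpose across `adj'`, which is how it enters the
verifications below. -/
lemma map_monadComparison_counit (X : A) :
    F'.map (monadComparison adj adj' K e X) ≫ adj'.counit.app (F'.obj X) =
      e.inv.app _ ≫ K.map (adj.counit.app (F.obj X)) ≫ e.hom.app X :=
  (adj'.homEquiv_counit _ _ _).symm.trans ((adj'.homEquiv _ _).symm_apply_apply _)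

lemma map_monadComparisonInv_counit (X : A) :
    K.map (F.map (monadComparisonInv adj adj' hK e X) ≫ adj.counit.app (F.obj X)) =
      e.hom.app _ ≫ adj'.counit.app (F'.obj X) ≫ e.inv.app X :=
  (congrArg K.map ((adj.homEquiv_counit _ _ _).symm.trans
    ((adj.homEquiv _ _).symm_apply_apply _))).trans (hK.map_preimage _)

/-- Two adjunctions whose left adjoints agree up to a fully faithful functor have isomorphic
monads. -/
def monadIsoOfFullyFaithful : adj.toMonad ≅ adj'.toMonad :=
  MonadIso.mk
    (NatIso.ofComponents (F := F ⋙ G) (G := F' ⋙ G')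
      (fun X =>
        { hom := monadComparison adj adj' K e X
          inv := monadComparisonInv adj adj' hK e X
          hom_inv_id := by
            -- Transposing and then applying the faithful `K` moves the identity into `B'`, where
            -- both comparisons have explicit transposes.
            apply (adj.homEquiv _ _).symm.injective
            apply hK.map_injective
            rw [adj.homEquiv_counit, adj.homEquiv_counit, F.map_comp, Category.assoc,
              K.map_comp, map_monadComparisonInv_counit]
            have n := e.hom.naturality (monadComparison adj adj' K e X)
            dsimp only [Functor.comp_map, Functor.comp_obj] at n ⊢
            rw [reassoc_of% n, reassoc_of% map_monadComparison_counit adj adj' e X]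
            simp
          inv_hom_id := by
            apply (adj'.homEquiv _ _).symm.injective
            rw [adj'.homEquiv_counit, adj'.homEquiv_counit, F'.map_comp, Category.assoc,
              map_monadComparison_counit]
            have n := e.inv.naturality (monadComparisonInv adj adj' hK e X)
            have m := map_monadComparisonInv_counit adj adj' hK e X
            dsimp only [Functor.comp_map, Functor.comp_obj] at n ⊢
            rw [K.map_comp] at m
            rw [reassoc_of% n, reassoc_of% m]
            simp })
      (fun {X Y} f => by
        apply (adj'.homEquiv _ _).symm.injective
        have n := e.inv.naturality (G.map (F.map f))
        have n' := e.hom.naturality f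
        dsimp only [Functor.comp_map, Functor.comp_obj] at n n' ⊢
        rw [adj'.homEquiv_counit, adj'.homEquiv_counit, F'.map_comp, F'.map_comp, Category.assoc,
          Category.assoc, map_monadComparison_counit, adj'.counit_naturality,
          reassoc_of% map_monadComparison_counit adj adj' e X, reassoc_of% n, ← n',
          ← K.map_comp_assoc]
        erw [adj.counit_naturality]
        rw [K.map_comp_assoc]))
    (fun X => by
      change adj.unit.app X ≫ monadComparison adj adj' K e X = adj'.unit.app X
      apply (adj'.homEquiv _ _).symm.injective
      have n := e.inv.naturality (adj.unit.app X)
      dsimp only [Functor.comp_map, Functor.comp_obj, Functor.id_obj] at n ⊢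
      rw [adj'.homEquiv_counit, adj'.homEquiv_counit, F'.map_comp, Category.assoc,
        map_monadComparison_counit, reassoc_of% n, ← K.map_comp_assoc]
      simp)
    (fun X => by
      change G.map (adj.counit.app (F.obj X)) ≫ monadComparison adj adj' K e X =
        (G.map (F.map (monadComparison adj adj' K e X)) ≫
          monadComparison adj adj' K e (G'.obj (F'.obj X))) ≫ G'.map (adj'.counit.app (F'.obj X))
      apply (adj'.homEquiv _ _).symm.injective
      have n := e.inv.naturality (G.map (adj.counit.app (F.obj X)))
      have n' := e.inv.naturality (G.map (F.map (monadComparison adj adj' K e X)))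
      have n'' := e.hom.naturality (monadComparison adj adj' K e X)
      dsimp only [Functor.comp_map, Functor.comp_obj, Functor.id_obj] at n n' n'' ⊢
      rw [adj'.homEquiv_counit, adj'.homEquiv_counit]
      simp only [F'.map_comp, Category.assoc]
      rw [map_monadComparison_counit, adj'.counit_naturality,
        reassoc_of% map_monadComparison_counit adj adj' e, reassoc_of% n, reassoc_of% n',
        ← K.map_comp_assoc, ← K.map_comp_assoc]
      erw [adj.counit_naturality, adj.counit_naturality]
      rw [K.map_comp_assoc, K.map_comp_assoc, reassoc_of% n'', map_monadComparison_counit]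
      simp)

end

end MonadIso

/-! ### Assembly: exponentials, the dual monad and LPC models -/

noncomputable section

/-- The comonad of a symmetric monoidal adjunction is linear exponential. -/
def IsMonoidalAdjunction.exponential {P : Type u₁} [Category.{v₁} P] [MonoidalCategory P]
    [SymmetricCategory P] {L : Type u₂} [Category.{v₂} L] [MonoidalCategory L]
    [SymmetricCategory L] [NaturalComonoids P] {F : P ⥤ L} {G : L ⥤ P} [F.LaxBraided]
    [G.LaxBraided] {adj : F ⊣ G} (h : IsMonoidalAdjunction adj) :
    LinearExponentialComonad adj.toComonad :=
  letI := h.leftAdjointBraided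
  -- The new braided structure has the original lax structure of `F` underneath, so the unit and
  -- counit conditions carry over definitionally.
  IsMonoidalAdjunction.linearExponentialComonad (F := F) (adj := adj) ⟨h.unit, h.counit⟩

/-- The monad of a symmetric comonoidal adjunction is linear exponential. -/
def IsComonoidalAdjunction.exponential {C : Type u₁} [Category.{v₁} C] [MonoidalCategory C]
    [SymmetricCategory C] {L : Type u₂} [Category.{v₂} L] [MonoidalCategory L]
    [SymmetricCategory L] [NaturalMonoids C] {F : L ⥤ C} {G : C ⥤ L} [SymmetricComonoidal F]
    [SymmetricComonoidal G] {adj : F ⊣ G} (h : IsComonoidalAdjunction adj) :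
    LinearExponentialMonad adj.toMonad :=
  letI := h.rightAdjointBraided
  IsComonoidal.linearExponentialMonad (G := G) (adj := adj) h.unit h.counit

section

variable {A : Type u₁} [Category.{v₁} A] {E : Type u₂} [Category.{v₂} E] {Q : Type u₃}
  [Category.{v₃} Q] {H : A ⥤ Eᵒᵖ} {K : Eᵒᵖ ⥤ A} (a : H ⊣ K) {F : Q ⥤ E} {G : E ⥤ Q}

lemma comp_op_toMonad_η_app (b : F ⊣ G) (X : A) :
    (a.comp b.op).toMonad.η.app X = a.unit.app X ≫ K.map (b.counit.app (H.obj X).unop).op := by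
  simp
  rfl

lemma comp_op_toMonad_μ_app (b : F ⊣ G) (X : A) :
    (a.comp b.op).toMonad.μ.app X = K.map
      (F.map (b.unit.app (G.obj (H.obj X).unop)) ≫
        F.map (G.map (a.counit.app (op (F.obj (G.obj (H.obj X).unop)))).unop)).op := by
  simp
  rfl

/-- Composing with the adjunction of a comonad or with the Eilenberg-Moore adjunction gives the
same monad. -/
def compAdjOpToMonadIso (b : F ⊣ G) :
    (a.comp b.toComonad.adj.op).toMonad ≅ (a.comp b.op).toMonad :=
  -- Both monads have the same underlying functor and the comparison is the identity. Only units and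
  -- multiplications need checking, and they agree because the coalgebra adjunction has the counit
  -- of the comonad as counit and the coalgebra structure maps as unit.
  MonadIso.mk (NatIso.ofComponents (F := H ⋙ (G ⋙ F).op ⋙ K) (G := H ⋙ (G ⋙ F).op ⋙ K)
      (fun _ => Iso.refl _) (fun _ => (Category.comp_id _).trans (Category.id_comp _).symm))
    (fun X => by
      refine (Category.comp_id _).trans ?_
      rw [comp_op_toMonad_η_app, comp_op_toMonad_η_app, Comonad.adj_counit]
      rfl)
    (fun X => by
      refine (Category.comp_id _).trans (Eq.trans ?_ (congrArg (· ≫ _)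
        ((congrArg (· ≫ _) ((a.comp b.toComonad.adj.op).toMonad.map_id _)).trans
          (Category.comp_id _)).symm))
      refine Eq.trans ?_ (Category.id_comp _).symm
      rw [comp_op_toMonad_μ_app, comp_op_toMonad_μ_app, Comonad.adj_unit]
      rfl)

end

namespace Model

variable {L : Type u₁} [Category.{v₁} L] [MonoidalCategory L] [SymmetricCategory L]
  {P : Type u₂} [Category.{v₂} P] [MonoidalCategory P] [SymmetricCategory P]
  {C : Type u₃} [Category.{v₃} C] [MonoidalCategory C] [SymmetricCategory C]

/-- The model of classical linear logic on the linear category of an LPC model, with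
`A ⊸ B = A^⊥ ⅋ B`. -/
def classicalModel (M : Model L P C) : ClassicalModel L M.bot M.bang :=
  letI := M.par
  letI := M.linearlyDistributive
  letI := M.negation
  letI := M.comonoids
  letI := M.floor_monoidal
  letI := M.Fbang_monoidal
  { closed := parClosed L
    dualizing := isIso_toDoubleDual
    hasFiniteProducts := M.hasFiniteProducts
    hasFiniteCoproducts := M.hasFiniteCoproducts
    exponential := M.bangAdj_monoidal.exponential }

lemma curry_lollyEval (M : Model L P C) (A B : L) :
    M.classicalModel.curry (M.lollyEval A B) = 𝟙 (M.lolly A B) :=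
  letI := M.par
  letI := M.linearlyDistributive
  letI := M.negation
  curry_negEval A B

/-- The linear exponential monad on `(L, ⅋, ⊥)`. -/
def whynotExponential (M : Model L P C) :
    @LinearExponentialMonad L _ M.par.monoidal M.par.symmetric M.whynot :=
  letI := M.monoids
  @IsComonoidalAdjunction.exponential C _ _ _ L _ M.par.monoidal M.par.symmetric _ M.ceil M.Fwhynot
    M.ceil_comonoidal M.Fwhynot_comonoidal M.whynotAdj M.whynotAdj_comonoidal

/-- The functors `(-)^*` and `(-)_*` form an equivalence. -/
def starEquivalence (M : Model L P C) : Pᵒᵖ ≌ C :=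
  -- No triangle identity relates the two given isomorphisms. This constructor adjusts the unit to
  -- obtain one.
  CategoryTheory.Equivalence.mk M.star M.lowerStar.rightOp
    (NatIso.ofComponents (fun X => (M.starUnit.app X.unop).symm.op) (fun f =>
      Quiver.Hom.unop_inj (M.starUnit.inv.naturality f.unop).symm))
    M.starCounit

/-- The comparison of the left adjoints `A ↦ ⌊A ⊸ ⊥⌋^*` and `A ↦ ⌈A⌉`. -/
lemma nonempty_floor_dual_star_iso (M : Model L P C) :
    letI := M.classicalModel.closed
    Nonempty (((dual M.bot).rightOp ⋙ M.floor.op) ⋙ M.star ≅ M.ceil) := by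
  let := M.par
  let := M.linearlyDistributive
  let := M.negation
  let := parClosed L
  obtain ⟨e, he⟩ := exists_neg_ihom_iso (L := L)
  -- The component is `⌊A ⊸ ⊥⌋^* ≅ ⌈(A ⊸ ⊥)^⊥⌉ ≅ ⌈A⌉`.
  refine ⟨NatIso.ofComponents (fun A => M.floor_star _ ≪≫ M.ceil.mapIso (e A))
    (fun {A B} f => ?_)⟩
  have n := M.floor_star_natural ((MonoidalClosed.pre f).app (parUnit L))
  change M.star.map (M.floor.map ((MonoidalClosed.pre f).app (parUnit L))).op ≫
    (M.floor_star _).hom ≫ M.ceil.map (e B).hom =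
      ((M.floor_star _).hom ≫ M.ceil.map (e A).hom) ≫ M.ceil.map f
  rw [reassoc_of% n, ← M.ceil.map_comp, he, M.ceil.map_comp, Category.assoc]

/-- The coalgebra adjunction in the dual monad is first replaced by `F_! ⊣ ⌊-⌋`. The left adjoints
then agree up to the fully faithful `(-)^*`, so no comparison of right adjoints is required. -/
lemma nonempty_whynot_iso (M : Model L P C) : Nonempty (M.classicalModel.whynot ≅ M.whynot) := by
  let := M.classicalModel.closed
  obtain ⟨e⟩ := M.nonempty_floor_dual_star_iso
  exact ⟨compAdjOpToMonadIso (dualAdjunction M.bot) M.bangAdj ≪≫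
    monadIsoOfFullyFaithful _ M.whynotAdj M.starEquivalence.fullyFaithfulFunctor e⟩

end Model

end

end LPC

theorem mainTheorem5
    {L : Type u₁} [Category.{v₁} L] [MonoidalCategory L] [SymmetricCategory L]
    {P : Type u₂} [Category.{v₂} P] [MonoidalCategory P] [SymmetricCategory P]
    {C : Type u₃} [Category.{v₃} C] [MonoidalCategory C] [SymmetricCategory C]
    (M : LPC.Model L P C) :
    ∃ S : LPC.ClassicalModel L M.bot M.bang,
      (∀ A B : L, IsIso (S.curry (M.lollyEval A B))) ∧
      Nonempty (@LPC.LinearExponentialMonad L _ M.par.monoidal M.par.symmetric M.whynot) ∧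
      Nonempty (S.whynot ≅ M.whynot) := by
  refine ⟨M.classicalModel, fun A B => ?_, ⟨M.whynotExponential⟩, M.nonempty_whynot_iso⟩
  rw [M.curry_lollyEval]
  exact inferInstanceAs (IsIso (𝟙 (M.lolly A B)))
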